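/- Let $m\ge 2$ and let $(M^m,g)$ be a smooth Riemannian manifold of dimension $m$ without boundary. Let $(N^{m+1},h)$ be one of the space forms $\mathbb{R}^{m+1}$ (flat metric), $H^{m+1}$ (hyperbolic space, sectional curvature $-1$) or $S^{m+1}$ (the unit sphere in $\mathbb{R}^{m+2}$ with the round metric), and let $\phi:(M^m,g)\to (N^{m+1},h)$ be a smooth isometric immersion (a hypersurface). For a smooth function $f:M\to(0,\infty)$, put $$\tau(\phi)=\mathrm{Trace}_g\nabla d\phi,\qquad \tau_2(\phi)=\mathrm{Trace}_g\big(\nabla^\phi\nabla^\phi-\nabla^\phi_{\nabla^M}\big)\tau(\phi)-\mathrm{Trace}_g R^N(d\phi,\tau(\phi))d\phi,$$ $$\tau_{2,f}(\phi)=f\,\tau_2(\phi)+(\Delta f)\,\tau(\phi)+2\nabla^\phi_{\mathrm{grad} f}\tau(\phi),$$ where $\nabla^\phi$ is the pull-back of the Levi-Civita connection of $N$, $R^N(X,Y)Z=[\nabla^N_X,\nabla^N_Y]Z-\nabla^N_{[X,Y]}Z$, and $\Delta f$ is the trace of the Hessian of $f$. The hypersurface is $f$-biharmonic if $\tau_{2,f}(\phi)=0$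 on $M$ for some smooth $f:M\to(0,\infty)$. It is totally umbilical if its second fundamental form $B=\nabla d\phi$ satisfies $B(X,Y)=g(X,Y)\,\eta$, where $\eta=\frac1m\mathrm{Trace}_g B$ is the mean curvature vector, and totally geodesic if $B=0$. Suppose that $\phi$ is totally umbilical and $f$-biharmonic. 1. If $N=\mathbb{R}^{m+1}$ or $N=H^{m+1}$, then $\phi$ is totally geodesic. 2. If $N=S^{m+1}$ and $M$ is connected, then, up to an isometry of $S^{m+1}$ (the restriction of an orthogonal transformation of $\mathbb{R}^{m+2}$), the image $\phi(M)$ is a part (a relatively open subset) of the great sphere $S^m=\{x\in S^{m+1}: x_1=0\}$ or of the small sphere $S^m(1/\sqrt2)=\{(1/\sqrt2,x)\in\mathbb{R}\times\mathbb{R}^{m+1}: |x|=1/\sqrt2\}$. -/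

import Mathlib

open scoped Manifold ContDiff

/-- The Euclidean space `ℝⁿ`. -/
abbrev Euc (n : ℕ) : Type := EuclideanSpace ℝ (Fin n)

namespace FBiharm

noncomputable section

/-! ### Riemannian geometry in coordinates

Coordinates run through (open parts of) `ℝⁿ`.  A metric in coordinates is written
`G : Euc n → Euc n → Euc n → ℝ`, where `G x u v` is the inner product of the tangent vectors
`u, v` at the point `x`. -/

/-- The `i`-th coordinate vector field `∂_i`. -/
def bvec {n : ℕ} (i : Fin n) : Euc n := EuclideanSpace.single i 1

/-- The matrix `g^{ij}(x)`, inverse of `g_{ij}(x) = G x ∂_i ∂_j`. -/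
def invGram {n : ℕ} (G : Euc n → Euc n → Euc n → ℝ) (x : Euc n) : Matrix (Fin n) (Fin n) ℝ :=
  (Matrix.of fun i j => G x (bvec i) (bvec j))⁻¹

/-- The Christoffel symbols of the Levi-Civita connection, as a vector valued bilinear form:
`Γ(u, v) = ½ g^{kl} (∂_u g(v, ∂_l) + ∂_v g(u, ∂_l) - ∂_l g(u, v)) ∂_k`. For vector fields
`u, v` with constant coefficients, `∇_u v = Γ(u, v)`. -/
def christoffel {n : ℕ} (G : Euc n → Euc n → Euc n → ℝ) (x u v : Euc n) : Euc n :=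
  ∑ k, ∑ l, (invGram G x k l * ((1 / 2) *
    (fderiv ℝ (fun y => G y v (bvec l)) x u + fderiv ℝ (fun y => G y u (bvec l)) x v
      - fderiv ℝ (fun y => G y u v) x (bvec l)))) • bvec k

/-- The curvature `R(u, v)w = ∇_u ∇_v w - ∇_v ∇_u w - ∇_{[u,v]} w`, evaluated on vector fields with
constant coefficients (so that `[u, v] = 0` and `∇_v w = Γ(v, w)`). -/
def curvature {n : ℕ} (G : Euc n → Euc n → Euc n → ℝ) (x u v w : Euc n) : Euc n :=
  (fderiv ℝ (fun y => christoffel G y v w) x u + christoffel G x u (christoffel G x v w))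
    - (fderiv ℝ (fun y => christoffel G y u w) x v + christoffel G x v (christoffel G x u w))

/-- The trace `g^{ij} B(∂_i, ∂_j)` of a bilinear form at the point `x`. -/
def traceG {n : ℕ} {F : Type*} [AddCommGroup F] [Module ℝ F] (G : Euc n → Euc n → Euc n → ℝ)
    (x : Euc n) (B : Euc n → Euc n → F) : F :=
  ∑ i, ∑ j, invGram G x i j • B (bvec i) (bvec j)

/-- The gradient of a function, `g^{ij} (∂_j f) ∂_i`. -/
def gradG {n : ℕ} (G : Euc n → Euc n → Euc n → ℝ) (f : Euc n → ℝ) (x : Euc n) : Euc n :=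
  ∑ i, ∑ j, (invGram G x i j * fderiv ℝ f x (bvec j)) • bvec i

/-- The Laplace-Beltrami operator, the trace of the Hessian:
`Δ f = g^{ij} (∂_i ∂_j f - Γ^k_{ij} ∂_k f)`. -/
def laplaceG {n : ℕ} (G : Euc n → Euc n → Euc n → ℝ) (f : Euc n → ℝ) (x : Euc n) : ℝ :=
  traceG G x fun u v => fderiv ℝ (fun y => fderiv ℝ f y v) x u - fderiv ℝ f x (christoffel G x u v)

/-- The pull-back connection `∇^φ` on vector fields along the map `φ` (into a space with the
metric `H`): `(∇^φ_u V)(x) = ∂_u V + Γ^H(dφ(u), V)`. -/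
def covAlong {n k : ℕ} (H : Euc k → Euc k → Euc k → ℝ) (φ : Euc n → Euc k) (V : Euc n → Euc k)
    (x u : Euc n) : Euc k :=
  fderiv ℝ V x u + christoffel H (φ x) (fderiv ℝ φ x u) (V x)

/-- The second fundamental form `(∇ dφ)(u, v) = ∇^φ_u (dφ(v)) - dφ(∇_u v)` of a map. -/
def secondFF {n k : ℕ} (G : Euc n → Euc n → Euc n → ℝ) (H : Euc k → Euc k → Euc k → ℝ)
    (φ : Euc n → Euc k) (x u v : Euc n) : Euc k :=
  covAlong H φ (fun y => fderiv ℝ φ y v) x u - fderiv ℝ φ x (christoffel G x u v)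

/-- The tension field `τ(φ) = Trace_g ∇ dφ`. -/
def tension {n k : ℕ} (G : Euc n → Euc n → Euc n → ℝ) (H : Euc k → Euc k → Euc k → ℝ)
    (φ : Euc n → Euc k) (x : Euc n) : Euc k :=
  traceG G x (secondFF G H φ x)

/-- The bitension field
`τ₂(φ) = Trace_g (∇^φ ∇^φ - ∇^φ_{∇^M}) τ(φ) - Trace_g R^N(dφ, τ(φ)) dφ`. -/
def bitension {n k : ℕ} (G : Euc n → Euc n → Euc n → ℝ) (H : Euc k → Euc k → Euc k → ℝ)
    (φ : Euc n → Euc k) (x : Euc n) : Euc k :=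
  traceG G x (fun u v =>
      covAlong H φ (fun y => covAlong H φ (tension G H φ) y v) x u
        - covAlong H φ (tension G H φ) x (christoffel G x u v))
    - traceG G x (fun u v =>
      curvature H (φ x) (fderiv ℝ φ x u) (tension G H φ x) (fderiv ℝ φ x v))

/-- The `f`-bitension field `τ_{2,f}(φ) = f τ₂(φ) + (Δ f) τ(φ) + 2 ∇^φ_{grad f} τ(φ)`. -/
def fBitension {n k : ℕ} (G : Euc n → Euc n → Euc n → ℝ) (H : Euc k → Euc k → Euc k → ℝ)
    (φ : Euc n → Euc k) (f : Euc n → ℝ) (x : Euc n) : Euc k :=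
  f x • bitension G H φ x + laplaceG G f x • tension G H φ x
    + (2 : ℝ) • covAlong H φ (tension G H φ) x (gradG G f x)

/-! ### Maps between Riemannian manifolds -/

/-- A family of bilinear forms on the tangent spaces of an `n`-dimensional manifold. -/
abbrev MetricTensor (n : ℕ) (N : Type*) [TopologicalSpace N] [ChartedSpace (Euc n) N] :=
  ∀ x : N, TangentSpace (𝓡 n) x → TangentSpace (𝓡 n) x → ℝ

/-- The metric tensor of a smooth Riemannian metric. -/
def metricOf {n : ℕ} {N : Type*} [TopologicalSpace N] [ChartedSpace (Euc n) N]
    [IsManifold (𝓡 n) ∞ N]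
    (g : Bundle.ContMDiffRiemannianMetric (𝓡 n) ∞ (Euc n) (fun x : N => TangentSpace (𝓡 n) x)) :
    MetricTensor n N :=
  fun x u v => g.inner x u v

/-- The expression of a metric tensor in a chart `e`:
`(u, v) ↦ h(d(e⁻¹)_y u, d(e⁻¹)_y v)` at the point `y` of the target of `e`. -/
def metricInChart {n : ℕ} {N : Type*} [TopologicalSpace N] [ChartedSpace (Euc n) N]
    (h : MetricTensor n N) (e : OpenPartialHomeomorph N (Euc n)) : Euc n → Euc n → Euc n → ℝ :=
  fun y u v => h (e.symm y) (mfderiv (𝓡 n) (𝓡 n) e.symm y u) (mfderiv (𝓡 n) (𝓡 n) e.symm y v)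

section Maps

variable {m n : ℕ} {M N : Type*} [TopologicalSpace M] [ChartedSpace (Euc m) M]
  [TopologicalSpace N] [ChartedSpace (Euc n) N]

/-- A smooth map `φ : (M, g) → (N, h)` with `φ^* h = g`. -/
def IsIsometricImmersion (g : MetricTensor m M) (h : MetricTensor n N) (φ : M → N) : Prop :=
  ContMDiff (𝓡 m) (𝓡 n) ∞ φ ∧
    ∀ (p : M) (u v : TangentSpace (𝓡 m) p),
      h (φ p) (mfderiv (𝓡 m) (𝓡 n) φ p u) (mfderiv (𝓡 m) (𝓡 n) φ p v) = g p u v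

/-- `φ : (M, g) → (N, h)` satisfies the `f`-biharmonic map equation `τ_{2,f}(φ) = 0`: the
equation holds at every point, in all pairs of charts of `M` and `N`. -/
def IsFBiharmonicMap (g : MetricTensor m M) (h : MetricTensor n N) (φ : M → N) (f : M → ℝ) :
    Prop :=
  ∀ e ∈ atlas (Euc m) M, ∀ e' ∈ atlas (Euc n) N, ∀ p ∈ e.source, φ p ∈ e'.source →
    fBitension (metricInChart g e) (metricInChart h e') (e' ∘ φ ∘ e.symm) (f ∘ e.symm) (e p) = 0

/-- `φ : (M, g) → (N, h)` is `f`-biharmonic for some smooth positive function `f` on `M`. -/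
def IsFBiharmonic (g : MetricTensor m M) (h : MetricTensor n N) (φ : M → N) : Prop :=
  ∃ f : M → ℝ, ContMDiff (𝓡 m) 𝓘(ℝ, ℝ) ∞ f ∧ (∀ p, 0 < f p) ∧ IsFBiharmonicMap g h φ f

/-- Total umbilicity of an isometric immersion: the second fundamental form is
`B(u, v) = g(u, v) η`, where `η = (1/m) Trace_g B` is the mean curvature vector
(equivalently `A(X) = H X` for a hypersurface with unit normal `ξ` and `η = H ξ`). -/
def IsTotallyUmbilical (g : MetricTensor m M) (h : MetricTensor n N) (φ : M → N) : Prop :=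
  ∀ e ∈ atlas (Euc m) M, ∀ e' ∈ atlas (Euc n) N, ∀ p ∈ e.source, φ p ∈ e'.source →
    ∀ u v : Euc m,
      secondFF (metricInChart g e) (metricInChart h e') (e' ∘ φ ∘ e.symm) (e p) u v =
        metricInChart g e (e p) u v • ((1 / (m : ℝ)) •
          tension (metricInChart g e) (metricInChart h e') (e' ∘ φ ∘ e.symm) (e p))

/-- An isometric immersion is totally geodesic if its second fundamental form vanishes. -/
def IsTotallyGeodesic (g : MetricTensor m M) (h : MetricTensor n N) (φ : M → N) : Prop :=
  ∀ e ∈ atlas (Euc m) M, ∀ e' ∈ atlas (Euc n) N, ∀ p ∈ e.source, φ p ∈ e'.source →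
    ∀ u v : Euc m,
      secondFF (metricInChart g e) (metricInChart h e') (e' ∘ φ ∘ e.symm) (e p) u v = 0

end Maps

/-! ### The space forms -/

/-- The flat metric of `ℝⁿ`. -/
def euclideanMetric (n : ℕ) : MetricTensor n (Euc n) :=
  fun _ u v => inner ℝ (show Euc n from u) (show Euc n from v)

/-- The unit sphere `S^n ⊆ ℝ^{n+1}`. -/
abbrev UnitSphere (n : ℕ) : Type := Metric.sphere (0 : Euc (n + 1)) 1

/-- The round metric of `S^n`, induced by the inclusion into `ℝ^{n+1}`. -/
def sphereMetric (n : ℕ) : MetricTensor n (UnitSphere n) :=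
  fun x u v => euclideanMetric (n + 1) (x : Euc (n + 1))
    (mfderiv (𝓡 n) (𝓡 (n + 1)) (Subtype.val : UnitSphere n → Euc (n + 1)) x u)
    (mfderiv (𝓡 n) (𝓡 (n + 1)) (Subtype.val : UnitSphere n → Euc (n + 1)) x v)

/-- The open unit ball of `ℝⁿ`. -/
def unitBall (n : ℕ) : TopologicalSpace.Opens (Euc n) := ⟨Metric.ball 0 1, Metric.isOpen_ball⟩

/-- Hyperbolic space `H^n`, in the Poincaré ball model. -/
abbrev HypSpace (n : ℕ) : Type := unitBall n

/-- The Poincaré metric `4 |dx|² / (1 - |x|²)²`, of constant sectional curvature `-1`. -/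
def hyperbolicMetric (n : ℕ) : MetricTensor n (HypSpace n) :=
  fun x u v => 4 / (1 - ‖(x : Euc n)‖ ^ 2) ^ 2 * euclideanMetric n (x : Euc n)
    (mfderiv (𝓡 n) (𝓡 n) (Subtype.val : HypSpace n → Euc n) x u)
    (mfderiv (𝓡 n) (𝓡 n) (Subtype.val : HypSpace n → Euc n) x v)

/-- The great sphere `S^m ⊆ S^{m+1}`: the unit vectors with first coordinate `0`. -/
def greatSphere (m : ℕ) : Set (UnitSphere (m + 1)) := {x | (x : Euc (m + 1 + 1)) 0 = 0}

/-- The small sphere `S^m(1/√2) ⊆ S^{m+1}`: the points `(1/√2, x)` of `S^{m+1}`; then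
`|x| = 1/√2`. -/
def smallSphere (m : ℕ) : Set (UnitSphere (m + 1)) :=
  {x | (x : Euc (m + 1 + 1)) 0 = 1 / Real.sqrt 2}

/-- Up to an isometry of `S^{m+1}` (the restriction of an orthogonal map `Ψ` of `ℝ^{m+2}`), the
image of `φ` is a part, that is, a relatively open subset, of `S`. -/
def IsPartOfUpToIsometry {m : ℕ} {M : Type*} (φ : M → UnitSphere (m + 1))
    (S : Set (UnitSphere (m + 1))) : Prop :=
  ∃ Ψ : Euc (m + 1 + 1) ≃ₗᵢ[ℝ] Euc (m + 1 + 1), ∃ W : Set (UnitSphere (m + 1)), IsOpen W ∧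
    {y : UnitSphere (m + 1) | ∃ p, (y : Euc (m + 1 + 1)) = Ψ (φ p)} = W ∩ S

end

end FBiharm

/-! All three ambient spaces are, in their charts, the conformally flat metric F⁻²⟨·,·⟩ with F = α +
β|y|², which has constant curvature K = 4αβ: (α, β) is (1, 0) for Euclidean space, (1/2, -1/2) for
the Poincaré ball, and (1, 1/4) for stereographic coordinates. The local argument is therefore
carried out once, for `IsConfImmersion`, and needs only explicit formulas for the Christoffel
symbols and the curvature.

Near a point choose a unit normal N. Umbilicity gives B = c g N for a function c, and ∇N = -c dψ.
Since the ambient curvature has no normal component on tangent vectors, Codazzi's equation reads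
dc(w) g(u,v) = dc(u) g(w,v). Taking v = u orthogonal to w, possible because m ≥ 2, yields dc = 0
(`exists_normal_of_umbilical`). With c constant, τ = mcN and ∇τ = -mc² dψ, so the f-bitension field
splits into the normal part mc(mf(K - c²) + Δf)N and the tangential part -2mc² dψ(grad f)
(`fBitension_eq`). If c ≠ 0, the tangential part forces df = 0 nearby, hence Δf = 0, and the normal
part leaves c² = K (`mean_curvature_of_fBiharmonic`). For K ≤ 0 only c = 0 survives, and B = 0.

On the sphere c is 0 or ±1. With x the position vector and ν the image of N in the ambient Euclidean
space, C = ν + cx has zero derivative, so locally the image lies in the hyperplane ⟨x, C⟩ = c with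
|C|² = 1 + c². The pair (C, c) is determined up to sign by the germ of the hypersurface, so
connectedness makes it global (`exists_smallSphere`). The inverse function theorem shows that the
image is open in that slice (`eventually_mem_range`), and a reflection moves C onto the first
coordinate axis (`isPartOfUpToIsometry`). -/

namespace FBiharm

noncomputable section

open Filter Topology RealInnerProductSpace

/-! ### Conformally flat metrics of constant curvature -/

section Conformal

variable {k : ℕ}

lemma inner_bvec_smul_sum (a : Euc k) : ∑ i, ⟪a, bvec i⟫ • bvec i = a := by
  have h := (EuclideanSpace.basisFun (Fin k) ℝ).sum_repr' a
  simpa [bvec, real_inner_comm] using h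

lemma inner_bvec_bvec (i j : Fin k) :
    ⟪(bvec i : Euc k), bvec j⟫ = (1 : Matrix (Fin k) (Fin k) ℝ) i j := by
  rw [Matrix.one_apply]
  simp [bvec, EuclideanSpace.inner_single_left]

/-- The conformal factor `F(y) = α + β |y|²`. -/
def confFactor (α β : ℝ) (y : Euc k) : ℝ := α + β * ⟪y, y⟫

/-- The metric `F⁻² ⟨·, ·⟩`; its sectional curvature is `4 α β`. -/
def confMetric (α β : ℝ) (y u v : Euc k) : ℝ := (confFactor α β y ^ 2)⁻¹ * ⟪u, v⟫

/-- The Christoffel symbols of `F⁻² ⟨·, ·⟩`. -/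
def confChristoffel (α β : ℝ) (y u v : Euc k) : Euc k :=
  (-(2 * β) * (confFactor α β y)⁻¹) • (⟪y, u⟫ • v + ⟪y, v⟫ • u - ⟪u, v⟫ • y)

variable {α β : ℝ}

lemma hasDerivAt_confFactor {p : ℝ → Euc k} {p' : Euc k} {t : ℝ} (hp : HasDerivAt p p' t) :
    HasDerivAt (fun s => confFactor α β (p s)) (2 * β * ⟪p t, p'⟫) t := by
  have h := ((hp.inner ℝ hp).const_mul β).const_add α
  refine h.congr_deriv ?_
  rw [real_inner_comm (p t) p']
  ring

/-- This is metric compatibility of the connection: a' + Γ(p', a) is the covariant derivative of a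
field a along the curve p. Working along curves covers both constant-coefficient fields on the
ambient space and fields along an immersion. -/
lemma hasDerivAt_confMetric {p a b : ℝ → Euc k} {p' a' b' : Euc k} {t : ℝ}
    (hp : HasDerivAt p p' t) (ha : HasDerivAt a a' t) (hb : HasDerivAt b b' t)
    (hF : confFactor α β (p t) ≠ 0) :
    HasDerivAt (fun s => confMetric α β (p s) (a s) (b s))
      (confMetric α β (p t) (a' + confChristoffel α β (p t) p' (a t)) (b t)
        + confMetric α β (p t) (a t) (b' + confChristoffel α β (p t) p' (b t))) t := by
  have h := (((hasDerivAt_confFactor hp).pow 2).inv (pow_ne_zero 2 hF)).mul (ha.inner ℝ hb)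
  refine h.congr_deriv ?_
  simp only [confMetric, confChristoffel, inner_add_left, inner_add_right, inner_smul_left,
    inner_smul_right, inner_sub_left, inner_sub_right, RCLike.conj_to_real, Pi.pow_apply,
    Pi.inv_apply,
    real_inner_comm (a t) (p t), real_inner_comm p' (a t)]
  field_simp
  ring

lemma hasDerivAt_confChristoffel {p a b : ℝ → Euc k} {p' a' b' : Euc k} {t : ℝ}
    (hp : HasDerivAt p p' t) (ha : HasDerivAt a a' t) (hb : HasDerivAt b b' t)
    (hF : confFactor α β (p t) ≠ 0) :
    HasDerivAt (fun s => confChristoffel α β (p s) (a s) (b s))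
      (confChristoffel α β (p t) a' (b t) + confChristoffel α β (p t) (a t) b'
        + (4 * β ^ 2 * ⟪p t, p'⟫ * (confFactor α β (p t) ^ 2)⁻¹) •
          (⟪p t, a t⟫ • b t + ⟪p t, b t⟫ • a t - ⟪a t, b t⟫ • p t)
        + (-(2 * β) * (confFactor α β (p t))⁻¹) •
          (⟪p', a t⟫ • b t + ⟪p', b t⟫ • a t - ⟪a t, b t⟫ • p')) t := by
  have h := (((hasDerivAt_confFactor hp).inv hF).const_mul (-(2 * β))).smul
    ((((hp.inner ℝ ha).smul hb).add ((hp.inner ℝ hb).smul ha)).sub ((ha.inner ℝ hb).smul hp))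
  refine h.congr_deriv ?_
  simp only [confChristoffel, Pi.add_apply, Pi.sub_apply, Pi.smul_apply', Pi.inv_apply]
  match_scalars <;> field_simp <;> ring

lemma confChristoffel_comm (y u v : Euc k) :
    confChristoffel α β y u v = confChristoffel α β y v u := by
  simp only [confChristoffel, real_inner_comm u v]
  module

lemma confMetric_comm (y u v : Euc k) : confMetric α β y u v = confMetric α β y v u := by
  simp only [confMetric, real_inner_comm u v]

lemma confMetric_add_left (y u v w : Euc k) :
    confMetric α β y (u + v) w = confMetric α β y u w + confMetric α β y v w := by
  simp only [confMetric, inner_add_left]; ring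

lemma confMetric_sub_left (y u v w : Euc k) :
    confMetric α β y (u - v) w = confMetric α β y u w - confMetric α β y v w := by
  simp only [confMetric, inner_sub_left]; ring

lemma confMetric_smul_left (y : Euc k) (r : ℝ) (u w : Euc k) :
    confMetric α β y (r • u) w = r * confMetric α β y u w := by
  simp only [confMetric, inner_smul_left, RCLike.conj_to_real]; ring

lemma confMetric_add_right (y u v w : Euc k) :
    confMetric α β y w (u + v) = confMetric α β y w u + confMetric α β y w v := by
  simp only [confMetric, inner_add_right]; ring

lemma confMetric_sub_right (y u v w : Euc k) :
    confMetric α β y w (u - v) = confMetric α β y w u - confMetric α β y w v := by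
  simp only [confMetric, inner_sub_right]; ring

lemma confMetric_smul_right (y : Euc k) (r : ℝ) (u w : Euc k) :
    confMetric α β y w (r • u) = r * confMetric α β y w u := by
  simp only [confMetric, inner_smul_right]; ring

lemma confMetric_zero_left (y w : Euc k) : confMetric α β y 0 w = 0 := by simp [confMetric]

lemma confMetric_eq_zero_iff {y : Euc k} (hF : confFactor α β y ≠ 0) (u v : Euc k) :
    confMetric α β y u v = 0 ↔ ⟪u, v⟫ = 0 := by
  simp [confMetric, hF]

/-- The curvature identity for derivatives along a two-parameter family: `P`, `Q` are the
velocities, `S` the mixed derivative of the position, `V` the vector field. -/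
lemma confChristoffel_curvature {y : Euc k} (hF : confFactor α β y ≠ 0)
    (P Q S V VP VQ VPQ : Euc k) :
    (VPQ + (confChristoffel α β y S V + confChristoffel α β y Q VP
        + (4 * β ^ 2 * ⟪y, P⟫ * (confFactor α β y ^ 2)⁻¹) •
          (⟪y, Q⟫ • V + ⟪y, V⟫ • Q - ⟪Q, V⟫ • y)
        + (-(2 * β) * (confFactor α β y)⁻¹) •
          (⟪P, Q⟫ • V + ⟪P, V⟫ • Q - ⟪Q, V⟫ • P))
      + confChristoffel α β y P (VQ + confChristoffel α β y Q V))
    - (VPQ + (confChristoffel α β y S V + confChristoffel α β y P VQ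
        + (4 * β ^ 2 * ⟪y, Q⟫ * (confFactor α β y ^ 2)⁻¹) •
          (⟪y, P⟫ • V + ⟪y, V⟫ • P - ⟪P, V⟫ • y)
        + (-(2 * β) * (confFactor α β y)⁻¹) •
          (⟪Q, P⟫ • V + ⟪Q, V⟫ • P - ⟪P, V⟫ • Q))
      + confChristoffel α β y Q (VP + confChristoffel α β y P V))
    = (4 * α * β) • (confMetric α β y Q V • P - confMetric α β y P V • Q) := by
  -- Eliminating α in favour of F makes both sides rational in F, β and the inner products, with F ≠
  -- 0 the only side condition.
  have hF' : α = confFactor α β y - β * ⟪y, y⟫ := by simp [confFactor]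
  simp only [confMetric, confChristoffel, inner_add_right, inner_smul_right, inner_sub_right]
  rw [real_inner_comm y P, real_inner_comm y Q, real_inner_comm P Q]
  generalize confFactor α β y = F at *
  subst hF'
  match_scalars <;> field_simp <;> ring

lemma differentiableAt_confMetric_fst {y : Euc k} (hF : confFactor α β y ≠ 0) (u v : Euc k) :
    DifferentiableAt ℝ (fun z => confMetric α β z u v) y := by
  have : DifferentiableAt ℝ (fun z : Euc k => confFactor α β z) y :=
    ((differentiableAt_id.inner ℝ differentiableAt_id).const_mul β).const_add α
  unfold confMetric
  exact ((this.pow 2).inv (pow_ne_zero 2 hF)).mul_const _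

lemma hasDerivAt_line (y w : Euc k) : HasDerivAt (fun t : ℝ => y + t • w) w 0 := by
  simpa using ((hasDerivAt_id (0 : ℝ)).smul_const w).const_add y

/-- Converts the one-variable derivative formulas along curves into Fréchet derivatives, once
differentiability is known separately. -/
lemma fderiv_eq_of_hasDerivAt_line {F : Type*} [NormedAddCommGroup F] [NormedSpace ℝ F]
    {f : Euc k → F} {y w : Euc k} {d : F} (hf : DifferentiableAt ℝ f y)
    (h : HasDerivAt (fun t : ℝ => f (y + t • w)) d 0) : fderiv ℝ f y w = d :=
  (hf.hasFDerivAt.hasLineDerivAt w).unique h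

lemma fderiv_confMetric_fst {y : Euc k} (hF : confFactor α β y ≠ 0) (u v w : Euc k) :
    fderiv ℝ (fun z => confMetric α β z u v) y w
      = -(4 * β) * ⟪y, w⟫ * (confFactor α β y ^ 3)⁻¹ * ⟪u, v⟫ := by
  refine fderiv_eq_of_hasDerivAt_line (differentiableAt_confMetric_fst hF u v) ?_
  have h := hasDerivAt_confMetric (α := α) (β := β) (hasDerivAt_line y w)
    (hasDerivAt_const (0 : ℝ) u) (hasDerivAt_const (0 : ℝ) v) (by simpa using hF)
  refine h.congr_deriv ?_
  simp only [zero_smul, add_zero, zero_add, confMetric, confChristoffel, inner_add_left,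
    inner_add_right, inner_smul_left,
    inner_smul_right, inner_sub_left, inner_sub_right, RCLike.conj_to_real]
  rw [real_inner_comm u y, real_inner_comm w u]
  field_simp
  ring

lemma invGram_congr {G H : Euc k → Euc k → Euc k → ℝ} {y : Euc k} (h : G y = H y) :
    invGram G y = invGram H y := by
  simp only [invGram, h]

/-- Christoffel symbols depend only on the germ of the metric, so a metric read in a chart may be
replaced by the conformal model near each point of the chart's target. -/
lemma christoffel_congr {G H : Euc k → Euc k → Euc k → ℝ} {y : Euc k} (h : G =ᶠ[𝓝 y] H) :
    christoffel G y = christoffel H y := by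
  have e : ∀ a b, fderiv ℝ (fun z => G z a b) y = fderiv ℝ (fun z => H z a b) y := fun a b =>
    Filter.EventuallyEq.fderiv_eq (h.mono fun z hz => by simp only [hz])
  funext u v
  simp only [christoffel, invGram_congr h.eq_of_nhds, e]

lemma curvature_congr {G H : Euc k → Euc k → Euc k → ℝ} {y : Euc k} (h : G =ᶠ[𝓝 y] H) :
    curvature G y = curvature H y := by
  have e : ∀ a b, fderiv ℝ (fun z => christoffel G z a b) y
      = fderiv ℝ (fun z => christoffel H z a b) y := fun a b =>
    Filter.EventuallyEq.fderiv_eq (h.eventuallyEq_nhds.mono fun z hz => by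
      simp only [christoffel_congr hz])
  funext u v w
  simp only [curvature, christoffel_congr h, e]

lemma invGram_confMetric {y : Euc k} (hF : confFactor α β y ≠ 0) :
    invGram (confMetric α β) y = (confFactor α β y ^ 2) • (1 : Matrix (Fin k) (Fin k) ℝ) := by
  unfold invGram
  refine Matrix.inv_eq_right_inv ?_
  have : (Matrix.of fun i j => confMetric α β y (bvec i) (bvec j))
      = (confFactor α β y ^ 2)⁻¹ • (1 : Matrix (Fin k) (Fin k) ℝ) := by
    ext i j
    simp [confMetric, inner_bvec_bvec]
  rw [this, Matrix.smul_mul, Matrix.one_mul, smul_smul, inv_mul_cancel₀ (pow_ne_zero 2 hF),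
    one_smul]

lemma christoffel_confMetric {y : Euc k} (hF : confFactor α β y ≠ 0) (u v : Euc k) :
    christoffel (confMetric α β) y u v = confChristoffel α β y u v := by
  simp only [christoffel, invGram_confMetric hF, fderiv_confMetric_fst hF]
  have : ∀ i : Fin k, ∑ j, ((confFactor α β y ^ 2 • (1 : Matrix (Fin k) (Fin k) ℝ)) i j *
      (1 / 2 * (-(4 * β) * ⟪y, u⟫ * (confFactor α β y ^ 3)⁻¹ * ⟪v, bvec j⟫ +
        -(4 * β) * ⟪y, v⟫ * (confFactor α β y ^ 3)⁻¹ * ⟪u, bvec j⟫ -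
        -(4 * β) * ⟪y, bvec j⟫ * (confFactor α β y ^ 3)⁻¹ * ⟪u, v⟫))) • (bvec i : Euc k)
      = ⟪confChristoffel α β y u v, bvec i⟫ • bvec i := by
    intro i
    rw [← Finset.sum_smul]
    congr 1
    rw [Finset.sum_eq_single i (fun j _ hj => by simp [Matrix.one_apply_ne hj.symm])
      (fun h => absurd (Finset.mem_univ i) h)]
    simp only [confChristoffel, inner_add_left, inner_smul_left, inner_sub_left,
      RCLike.conj_to_real, Matrix.smul_apply, Matrix.one_apply_eq, smul_eq_mul]
    field_simp
    ring
  rw [Finset.sum_congr rfl fun i _ => this i, inner_bvec_smul_sum]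

lemma continuous_confFactor : Continuous fun y : Euc k => confFactor α β y := by
  unfold confFactor; fun_prop

lemma differentiableAt_confChristoffel {n : ℕ} {p a b : Euc n → Euc k} {x : Euc n}
    (hp : DifferentiableAt ℝ p x) (ha : DifferentiableAt ℝ a x) (hb : DifferentiableAt ℝ b x)
    (hF : confFactor α β (p x) ≠ 0) :
    DifferentiableAt ℝ (fun z => confChristoffel α β (p z) (a z) (b z)) x := by
  have h1 : DifferentiableAt ℝ (fun z => confFactor α β (p z)) x :=
    ((hp.inner ℝ hp).const_mul β).const_add α
  exact ((h1.inv hF).const_mul _).smul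
    ((((hp.inner ℝ ha).smul hb).add ((hp.inner ℝ hb).smul ha)).sub ((ha.inner ℝ hb).smul hp))

lemma curvature_confMetric {y : Euc k} (hF : confFactor α β y ≠ 0) (u v w : Euc k) :
    curvature (confMetric α β) y u v w
      = (4 * α * β) • (confMetric α β y v w • u - confMetric α β y u w • v) := by
  have hev : ∀ᶠ z in 𝓝 y, confFactor α β z ≠ 0 :=
    continuous_confFactor.continuousAt.eventually_ne hF
  have e : ∀ a b c, fderiv ℝ (fun z => christoffel (confMetric α β) z a b) y c
      = (4 * β ^ 2 * ⟪y, c⟫ * (confFactor α β y ^ 2)⁻¹) •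
          (⟪y, a⟫ • b + ⟪y, b⟫ • a - ⟪a, b⟫ • y)
        + (-(2 * β) * (confFactor α β y)⁻¹) • (⟪c, a⟫ • b + ⟪c, b⟫ • a - ⟪a, b⟫ • c) := by
    intro a b c
    have h1 : (fun z => christoffel (confMetric α β) z a b)
        =ᶠ[𝓝 y] fun z => confChristoffel α β z a b :=
      hev.mono fun z hz => christoffel_confMetric hz a b
    rw [h1.fderiv_eq]
    refine fderiv_eq_of_hasDerivAt_line (differentiableAt_confChristoffel differentiableAt_id
      (differentiableAt_const a) (differentiableAt_const b) hF) ?_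
    have h := hasDerivAt_confChristoffel (α := α) (β := β) (hasDerivAt_line y c)
      (hasDerivAt_const (0 : ℝ) a) (hasDerivAt_const (0 : ℝ) b) (by simpa using hF)
    refine h.congr_deriv ?_
    simp [confChristoffel]
  have h := confChristoffel_curvature hF u v 0 w 0 0 0
  simp only [curvature, e, christoffel_confMetric hF]
  rw [← h]
  simp only [confChristoffel, inner_zero_left, inner_zero_right, zero_smul, smul_zero, zero_add,
    sub_zero, add_zero]

end Conformal

/-! ### Linear algebra and calculus -/

/-- The orthogonal complement of a subspace of codimension one is a line. This is used for normals
of a hypersurface in a chart, and again in the Euclidean space around the sphere. -/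
lemma exists_smul_of_mem_orthogonal {E : Type*} [NormedAddCommGroup E] [InnerProductSpace ℝ E]
    [FiniteDimensional ℝ E] {W : Submodule ℝ E}
    (hW : Module.finrank ℝ W + 1 = Module.finrank ℝ E) {a b : E} (ha : a ≠ 0)
    (haW : a ∈ Wᗮ) (hbW : b ∈ Wᗮ) : ∃ c : ℝ, b = c • a := by
  have h1 : Module.finrank ℝ Wᗮ = 1 := by
    have := W.finrank_add_finrank_orthogonal
    omega
  obtain ⟨c, hc⟩ := (finrank_eq_one_iff_of_nonzero' (⟨a, haW⟩ : Wᗮ)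
    (by simpa [Subtype.ext_iff] using ha)).1 h1 ⟨b, hbW⟩
  exact ⟨c, by simpa using (congrArg Subtype.val hc).symm⟩

lemma exists_smul_of_orthogonal_range {m : ℕ} {L : Euc m →ₗ[ℝ] Euc (m + 1)}
    (hL : Function.Injective L) {a b : Euc (m + 1)} (ha : a ≠ 0)
    (haL : ∀ v, ⟪a, L v⟫ = 0) (hbL : ∀ v, ⟪b, L v⟫ = 0) : ∃ c : ℝ, b = c • a := by
  refine exists_smul_of_mem_orthogonal (W := LinearMap.range L) ?_ ha ?_ ?_
  · rw [LinearMap.finrank_range_of_inj hL]; simp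
  · rintro _ ⟨v, rfl⟩
    rw [real_inner_comm]; exact haL v
  · rintro _ ⟨v, rfl⟩
    rw [real_inner_comm]; exact hbL v

lemma exists_ne_zero_orthogonal_range {m : ℕ} (L : Euc m →ₗ[ℝ] Euc (m + 1)) :
    ∃ a : Euc (m + 1), a ≠ 0 ∧ ∀ v, ⟪a, L v⟫ = 0 := by
  have h := (LinearMap.range L).finrank_add_finrank_orthogonal
  have h2 := LinearMap.finrank_range_le L
  simp only [finrank_euclideanSpace, Fintype.card_fin] at h h2
  have : (LinearMap.range L)ᗮ ≠ ⊥ := by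
    intro h0
    rw [h0] at h
    simp at h
    omega
  obtain ⟨a, ha, ha0⟩ := Submodule.exists_mem_ne_zero_of_ne_bot this
  refine ⟨a, ha0, fun v => ?_⟩
  rw [real_inner_comm]
  exact ha _ ⟨v, rfl⟩

lemma eventually_eq_of_fderiv_eq_zero {E F : Type*} [NormedAddCommGroup E] [NormedSpace ℝ E]
    [NormedAddCommGroup F] [NormedSpace ℝ F] {f : E → F} {x : E}
    (h : ∀ᶠ y in 𝓝 x, DifferentiableAt ℝ f y ∧ fderiv ℝ f y = 0) : ∀ᶠ y in 𝓝 x, f y = f x := by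
  obtain ⟨ε, hε, hb⟩ := Metric.eventually_nhds_iff_ball.1 h
  obtain ⟨a, ha⟩ := Metric.isOpen_ball.exists_is_const_of_fderiv_eq_zero
    (convex_ball x ε).isPreconnected (fun y hy => (hb y hy).1.differentiableWithinAt)
    (fun y hy => (hb y hy).2)
  filter_upwards [Metric.ball_mem_nhds x hε] with y hy
  rw [ha y hy, ha x (Metric.mem_ball_self hε)]

section SecondDerivative

variable {n k : ℕ} {f : Euc n → Euc k} {x : Euc n}

lemma differentiableAt_fderiv_apply (hf : ContDiffAt ℝ 2 f x) (u : Euc n) :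
    DifferentiableAt ℝ (fun y => fderiv ℝ f y u) x :=
  ((hf.fderiv_right (m := 1) (by norm_num)).differentiableAt (by norm_num)).clm_apply
    (differentiableAt_const u)

lemma fderiv_fderiv_apply (hf : ContDiffAt ℝ 2 f x) (u w : Euc n) :
    fderiv ℝ (fun y => fderiv ℝ f y u) x w = fderiv ℝ (fderiv ℝ f) x w u := by
  have h := ((hf.fderiv_right (m := 1) (by norm_num)).differentiableAt (by norm_num))
  rw [fderiv_clm_apply h (differentiableAt_const u)]
  simp

lemma fderiv_fderiv_comm (hf : ContDiffAt ℝ 2 f x) (u w : Euc n) :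
    fderiv ℝ (fun y => fderiv ℝ f y u) x w = fderiv ℝ (fun y => fderiv ℝ f y w) x u := by
  rw [fderiv_fderiv_apply hf, fderiv_fderiv_apply hf]
  exact (hf.isSymmSndFDerivAt (by simp)) w u

lemma hasDerivAt_comp_line (hf : DifferentiableAt ℝ f x) (w : Euc n) :
    HasDerivAt (fun t : ℝ => f (x + t • w)) (fderiv ℝ f x w) 0 :=
  hf.hasFDerivAt.hasLineDerivAt w

end SecondDerivative

/-! ### Isometric immersions into conformally flat metrics -/

lemma covAlong_congr {n k : ℕ} {H : Euc k → Euc k → Euc k → ℝ} {ψ V W : Euc n → Euc k}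
    {x : Euc n} (h : V =ᶠ[𝓝 x] W) : covAlong H ψ V x = covAlong H ψ W x := by
  funext u
  simp only [covAlong, h.fderiv_eq, h.eq_of_nhds]

/-- `ψ` is an isometric immersion of the metric `G`, on the open set `U`, into the metric `H`,
which agrees with the conformally flat metric `F⁻² ⟨·, ·⟩` near the image. -/
structure IsConfImmersion {n k : ℕ} (α β : ℝ) (U : Set (Euc n)) (ψ : Euc n → Euc k)
    (G : Euc n → Euc n → Euc n → ℝ) (H : Euc k → Euc k → Euc k → ℝ) : Prop where
  isOpen : IsOpen U
  smooth : ∀ x ∈ U, ContDiffAt ℝ ∞ ψ x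
  factor_ne : ∀ x ∈ U, confFactor α β (ψ x) ≠ 0
  target : ∀ x ∈ U, H =ᶠ[𝓝 (ψ x)] confMetric α β
  pullback : ∀ x ∈ U, ∀ u v, G x u v = confMetric α β (ψ x) (fderiv ℝ ψ x u) (fderiv ℝ ψ x v)
  pos : ∀ x ∈ U, ∀ u, u ≠ 0 → 0 < G x u u

namespace IsConfImmersion

variable {n k : ℕ} {α β : ℝ} {U : Set (Euc n)} {ψ : Euc n → Euc k}
  {G : Euc n → Euc n → Euc n → ℝ} {H : Euc k → Euc k → Euc k → ℝ} {x : Euc n}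

lemma mem_nhds (h : IsConfImmersion α β U ψ G H) (hx : x ∈ U) : U ∈ 𝓝 x := h.isOpen.mem_nhds hx

lemma contDiffAt_two (h : IsConfImmersion α β U ψ G H) (hx : x ∈ U) : ContDiffAt ℝ 2 ψ x :=
  (h.smooth x hx).of_le (WithTop.coe_le_coe.2 (le_top : (2 : ℕ∞) ≤ ⊤))

lemma contDiffAt_fderiv (h : IsConfImmersion α β U ψ G H) (hx : x ∈ U) :
    ContDiffAt ℝ 2 (fderiv ℝ ψ) x :=
  (h.smooth x hx).fderiv_right (WithTop.coe_le_coe.2 (le_top : (2 + 1 : ℕ∞) ≤ ⊤))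

lemma contDiffAt_fderiv_apply (h : IsConfImmersion α β U ψ G H) (hx : x ∈ U) (v : Euc n) :
    ContDiffAt ℝ 2 (fun y => fderiv ℝ ψ y v) x :=
  (h.contDiffAt_fderiv hx).clm_apply contDiffAt_const

lemma differentiableAt (h : IsConfImmersion α β U ψ G H) (hx : x ∈ U) : DifferentiableAt ℝ ψ x :=
  (h.smooth x hx).differentiableAt (by simp)

lemma differentiableAt_fderiv_apply (h : IsConfImmersion α β U ψ G H) (hx : x ∈ U) (v : Euc n) :
    DifferentiableAt ℝ (fun y => fderiv ℝ ψ y v) x :=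
  (h.contDiffAt_fderiv_apply hx v).differentiableAt (by norm_num)

lemma fderiv_injective (h : IsConfImmersion α β U ψ G H) (hx : x ∈ U) :
    Function.Injective (fderiv ℝ ψ x) := by
  rw [injective_iff_map_eq_zero]
  intro u hu
  by_contra hne
  have := h.pos x hx u hne
  rw [h.pullback x hx, hu, confMetric_zero_left] at this
  exact lt_irrefl _ this

lemma covAlong_eq (h : IsConfImmersion α β U ψ G H) (hx : x ∈ U) (V : Euc n → Euc k) (u : Euc n) :
    covAlong H ψ V x u
      = fderiv ℝ V x u + confChristoffel α β (ψ x) (fderiv ℝ ψ x u) (V x) := by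
  rw [covAlong, christoffel_congr (h.target x hx), christoffel_confMetric (h.factor_ne x hx)]

lemma covAlong_smul (h : IsConfImmersion α β U ψ G H) (hx : x ∈ U) {V : Euc n → Euc k}
    (hV : DifferentiableAt ℝ V x) (r : ℝ) (u : Euc n) :
    covAlong H ψ (fun y => r • V y) x u = r • covAlong H ψ V x u := by
  rw [h.covAlong_eq hx, h.covAlong_eq hx, fderiv_fun_const_smul hV]
  simp only [confChristoffel, inner_smul_right, smul_apply]
  module

/-- Torsion-freeness: second derivatives of ψ and the Christoffel symbols are both symmetric. -/
lemma covAlong_comm (h : IsConfImmersion α β U ψ G H) (hx : x ∈ U) (u v : Euc n) :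
    covAlong H ψ (fun y => fderiv ℝ ψ y v) x u = covAlong H ψ (fun y => fderiv ℝ ψ y u) x v := by
  rw [h.covAlong_eq hx, h.covAlong_eq hx, fderiv_fderiv_comm (h.contDiffAt_two hx),
    confChristoffel_comm]

lemma hasDerivAt_confMetric_line (h : IsConfImmersion α β U ψ G H) (hx : x ∈ U)
    {V W : Euc n → Euc k} (hV : DifferentiableAt ℝ V x) (hW : DifferentiableAt ℝ W x) (u : Euc n) :
    HasDerivAt (fun t : ℝ => confMetric α β (ψ (x + t • u)) (V (x + t • u)) (W (x + t • u)))
      (confMetric α β (ψ x) (covAlong H ψ V x u) (W x)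
        + confMetric α β (ψ x) (V x) (covAlong H ψ W x u)) 0 := by
  have := hasDerivAt_confMetric (α := α) (β := β) (hasDerivAt_comp_line (h.differentiableAt hx) u)
    (hasDerivAt_comp_line hV u) (hasDerivAt_comp_line hW u) (by simpa using h.factor_ne x hx)
  simpa [h.covAlong_eq hx] using this

lemma differentiableAt_confMetric (h : IsConfImmersion α β U ψ G H) (hx : x ∈ U)
    {V W : Euc n → Euc k} (hV : DifferentiableAt ℝ V x) (hW : DifferentiableAt ℝ W x) :
    DifferentiableAt ℝ (fun y => confMetric α β (ψ y) (V y) (W y)) x := by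
  have hd := h.differentiableAt hx
  have h1 : DifferentiableAt ℝ (fun z => confFactor α β (ψ z)) x :=
    ((hd.inner ℝ hd).const_mul β).const_add α
  exact ((h1.pow 2).inv (pow_ne_zero 2 (h.factor_ne x hx))).mul (hV.inner ℝ hW)

/-- The pull-back connection is compatible with the metric. -/
lemma fderiv_confMetric (h : IsConfImmersion α β U ψ G H) (hx : x ∈ U)
    {V W : Euc n → Euc k} (hV : DifferentiableAt ℝ V x) (hW : DifferentiableAt ℝ W x) (u : Euc n) :
    fderiv ℝ (fun y => confMetric α β (ψ y) (V y) (W y)) x u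
      = confMetric α β (ψ x) (covAlong H ψ V x u) (W x)
        + confMetric α β (ψ x) (V x) (covAlong H ψ W x u) :=
  fderiv_eq_of_hasDerivAt_line (h.differentiableAt_confMetric hx hV hW)
    (h.hasDerivAt_confMetric_line hx hV hW u)

lemma differentiableAt_covAlong (h : IsConfImmersion α β U ψ G H) (hx : x ∈ U)
    {V : Euc n → Euc k} (hV : ContDiffAt ℝ 2 V x) (u : Euc n) :
    DifferentiableAt ℝ (fun y => covAlong H ψ V y u) x := by
  have : (fun y => covAlong H ψ V y u) =ᶠ[𝓝 x] fun y =>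
      fderiv ℝ V y u + confChristoffel α β (ψ y) (fderiv ℝ ψ y u) (V y) := by
    filter_upwards [h.mem_nhds hx] with y hy using h.covAlong_eq hy V u
  refine (DifferentiableAt.add ?_ ?_).congr_of_eventuallyEq this
  · exact FBiharm.differentiableAt_fderiv_apply hV u
  · exact differentiableAt_confChristoffel (h.differentiableAt hx)
      (h.differentiableAt_fderiv_apply hx u) (hV.differentiableAt (by norm_num))
      (h.factor_ne x hx)

lemma fderiv_covAlong (h : IsConfImmersion α β U ψ G H) (hx : x ∈ U)
    {V : Euc n → Euc k} (hV : ContDiffAt ℝ 2 V x) (u w : Euc n) :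
    fderiv ℝ (fun y => covAlong H ψ V y u) x w = fderiv ℝ (fun y => fderiv ℝ V y u) x w
      + (confChristoffel α β (ψ x) (fderiv ℝ (fun y => fderiv ℝ ψ y u) x w) (V x)
        + confChristoffel α β (ψ x) (fderiv ℝ ψ x u) (fderiv ℝ V x w)
        + (4 * β ^ 2 * ⟪ψ x, fderiv ℝ ψ x w⟫ * (confFactor α β (ψ x) ^ 2)⁻¹) •
          (⟪ψ x, fderiv ℝ ψ x u⟫ • V x + ⟪ψ x, V x⟫ • fderiv ℝ ψ x u
            - ⟪fderiv ℝ ψ x u, V x⟫ • ψ x)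
        + (-(2 * β) * (confFactor α β (ψ x))⁻¹) •
          (⟪fderiv ℝ ψ x w, fderiv ℝ ψ x u⟫ • V x + ⟪fderiv ℝ ψ x w, V x⟫ • fderiv ℝ ψ x u
            - ⟪fderiv ℝ ψ x u, V x⟫ • fderiv ℝ ψ x w)) := by
  have he : (fun y => covAlong H ψ V y u) =ᶠ[𝓝 x] fun y =>
      fderiv ℝ V y u + confChristoffel α β (ψ y) (fderiv ℝ ψ y u) (V y) := by
    filter_upwards [h.mem_nhds hx] with y hy using h.covAlong_eq hy V u
  have hd := (h.differentiableAt_covAlong hx hV u).congr_of_eventuallyEq he.symm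
  have hVd := hV.differentiableAt (by norm_num)
  rw [he.fderiv_eq]
  refine fderiv_eq_of_hasDerivAt_line hd ?_
  have h1 := hasDerivAt_confChristoffel (α := α) (β := β)
    (hasDerivAt_comp_line (h.differentiableAt hx) w)
    (hasDerivAt_comp_line (h.differentiableAt_fderiv_apply hx u) w) (hasDerivAt_comp_line hVd w)
    (by simpa using h.factor_ne x hx)
  have h2 := (hasDerivAt_comp_line (FBiharm.differentiableAt_fderiv_apply hV u) w).add h1
  simpa [Pi.add_def] using h2

/-- The curvature of the pull-back connection. -/
lemma covAlong_covAlong_sub (h : IsConfImmersion α β U ψ G H) (hx : x ∈ U)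
    {V : Euc n → Euc k} (hV : ContDiffAt ℝ 2 V x) (u w : Euc n) :
    covAlong H ψ (fun y => covAlong H ψ V y u) x w - covAlong H ψ (fun y => covAlong H ψ V y w) x u
      = (4 * α * β) • (confMetric α β (ψ x) (fderiv ℝ ψ x u) (V x) • fderiv ℝ ψ x w
          - confMetric α β (ψ x) (fderiv ℝ ψ x w) (V x) • fderiv ℝ ψ x u) := by
  have key := confChristoffel_curvature (h.factor_ne x hx) (fderiv ℝ ψ x w) (fderiv ℝ ψ x u)
    (fderiv ℝ (fun y => fderiv ℝ ψ y u) x w) (V x) (fderiv ℝ V x w) (fderiv ℝ V x u)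
    (fderiv ℝ (fun y => fderiv ℝ V y u) x w)
  rw [← key, h.covAlong_eq hx, h.covAlong_eq hx (fun y => covAlong H ψ V y w),
    h.fderiv_covAlong hx hV, h.fderiv_covAlong hx hV, h.covAlong_eq hx, h.covAlong_eq hx,
    fderiv_fderiv_comm hV w u, fderiv_fderiv_comm (h.contDiffAt_two hx) w u]

lemma fderiv_metric (h : IsConfImmersion α β U ψ G H) (hx : x ∈ U) (u v w : Euc n) :
    fderiv ℝ (fun y => G y u v) x w
      = confMetric α β (ψ x) (covAlong H ψ (fun y => fderiv ℝ ψ y u) x w) (fderiv ℝ ψ x v)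
        + confMetric α β (ψ x) (fderiv ℝ ψ x u) (covAlong H ψ (fun y => fderiv ℝ ψ y v) x w) := by
  have : (fun y => G y u v) =ᶠ[𝓝 x] fun y =>
      confMetric α β (ψ y) (fderiv ℝ ψ y u) (fderiv ℝ ψ y v) := by
    filter_upwards [h.mem_nhds hx] with y hy using h.pullback y hy u v
  rw [this.fderiv_eq, h.fderiv_confMetric hx (h.differentiableAt_fderiv_apply hx u)
    (h.differentiableAt_fderiv_apply hx v)]

lemma differentiableAt_metric (h : IsConfImmersion α β U ψ G H) (hx : x ∈ U) (u v : Euc n) :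
    DifferentiableAt ℝ (fun y => G y u v) x := by
  refine (h.differentiableAt_confMetric hx (h.differentiableAt_fderiv_apply hx u)
    (h.differentiableAt_fderiv_apply hx v)).congr_of_eventuallyEq ?_
  filter_upwards [h.mem_nhds hx] with y hy using h.pullback y hy u v

lemma metric_comm (h : IsConfImmersion α β U ψ G H) (hx : x ∈ U) (u v : Euc n) :
    G x u v = G x v u := by
  rw [h.pullback x hx, h.pullback x hx, confMetric_comm]

lemma confMetric_sum_left {ι : Type*} (s : Finset ι) (y : Euc k) (f : ι → Euc k) (w : Euc k) :
    confMetric α β y (∑ i ∈ s, f i) w = ∑ i ∈ s, confMetric α β y (f i) w := by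
  simp only [confMetric, sum_inner, Finset.mul_sum]

/-- The Gram matrix `g_{ij}`. -/
def gram (G : Euc n → Euc n → Euc n → ℝ) (x : Euc n) : Matrix (Fin n) (Fin n) ℝ :=
  Matrix.of fun i j => G x (bvec i) (bvec j)

/-- A kernel vector has coordinates of some a orthogonal to every ∂_j, hence to itself, and
positivity gives a = 0. Invertibility is what makes `invGram` a genuine inverse rather than the
default value 0. -/
lemma isUnit_gram (h : IsConfImmersion α β U ψ G H) (hx : x ∈ U) : IsUnit (gram G x) := by
  rw [← Matrix.mulVec_injective_iff_isUnit, ← Matrix.coe_mulVecLin, injective_iff_map_eq_zero]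
  intro v hv
  set a : Euc n := ∑ i, v i • bvec i with ha
  have h1 : ∀ j, G x a (bvec j) = 0 := by
    intro j
    have hj := congrFun hv j
    simp only [Matrix.mulVecLin_apply, Matrix.mulVec, dotProduct, gram, Matrix.of_apply,
      Pi.zero_apply] at hj
    rw [h.pullback x hx, ha, map_sum, confMetric_sum_left, ← hj]
    refine Finset.sum_congr rfl fun i _ => ?_
    rw [map_smul, confMetric_smul_left, ← h.pullback x hx, h.metric_comm hx, mul_comm]
  have h2 : G x a a = 0 := by
    rw [h.pullback x hx]
    have h3 : fderiv ℝ ψ x a = ∑ i, fderiv ℝ ψ x (v i • bvec i) := by rw [ha, map_sum]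
    rw [congrArg (fun b => confMetric α β (ψ x) b (fderiv ℝ ψ x a)) h3, confMetric_sum_left]
    refine Finset.sum_eq_zero fun i _ => ?_
    rw [map_smul, confMetric_smul_left, ← h.pullback x hx, h.metric_comm hx, h1, mul_zero]
  have h3 : a = 0 := by
    by_contra hne
    exact (h.pos x hx a hne).ne' h2
  funext j
  have h4 := congrArg (fun b : Euc n => b j) (ha.symm.trans h3)
  simpa [bvec, Finset.sum_apply, Pi.single_apply] using h4

lemma gram_mul_invGram (h : IsConfImmersion α β U ψ G H) (hx : x ∈ U) :
    gram G x * invGram G x = 1 :=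
  Matrix.mul_nonsing_inv _ ((Matrix.isUnit_iff_isUnit_det _).1 (h.isUnit_gram hx))

lemma sum_gram_mul_invGram (h : IsConfImmersion α β U ψ G H) (hx : x ∈ U) (i j : Fin n) :
    ∑ l, G x (bvec i) (bvec l) * invGram G x l j = (1 : Matrix (Fin n) (Fin n) ℝ) i j := by
  rw [← h.gram_mul_invGram hx, Matrix.mul_apply]
  rfl

/-- The Koszul formula. -/
lemma confMetric_fderiv_christoffel (h : IsConfImmersion α β U ψ G H) (hx : x ∈ U) (u v : Euc n)
    (j : Fin n) :
    confMetric α β (ψ x) (fderiv ℝ ψ x (christoffel G x u v)) (fderiv ℝ ψ x (bvec j))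
      = (1 / 2) * (fderiv ℝ (fun y => G y v (bvec j)) x u + fderiv ℝ (fun y => G y u (bvec j)) x v
        - fderiv ℝ (fun y => G y u v) x (bvec j)) := by
  simp only [christoffel, map_sum, map_smul, confMetric_sum_left, confMetric_smul_left,
    ← h.pullback x hx]
  rw [Finset.sum_comm]
  have : ∀ l, ∑ i, invGram G x i l * (1 / 2 * (fderiv ℝ (fun y => G y v (bvec l)) x u
      + fderiv ℝ (fun y => G y u (bvec l)) x v - fderiv ℝ (fun y => G y u v) x (bvec l)))
        * G x (bvec i) (bvec j)
      = (1 : Matrix (Fin n) (Fin n) ℝ) j l * (1 / 2 * (fderiv ℝ (fun y => G y v (bvec l)) x u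
      + fderiv ℝ (fun y => G y u (bvec l)) x v - fderiv ℝ (fun y => G y u v) x (bvec l))) := by
    intro l
    rw [← h.sum_gram_mul_invGram hx, Finset.sum_mul]
    refine Finset.sum_congr rfl fun i _ => ?_
    rw [h.metric_comm hx (bvec j) (bvec i)]
    ring
  rw [Finset.sum_congr rfl fun l _ => this l, Finset.sum_eq_single j
    (fun l _ hl => by rw [Matrix.one_apply_ne hl.symm, zero_mul])
    (fun hj => absurd (Finset.mem_univ j) hj), Matrix.one_apply_eq, one_mul]

/-- The second fundamental form is normal. -/
lemma confMetric_secondFF (h : IsConfImmersion α β U ψ G H) (hx : x ∈ U) (u v w : Euc n) :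
    confMetric α β (ψ x) (secondFF G H ψ x u v) (fderiv ℝ ψ x w) = 0 := by
  have hj : ∀ j, confMetric α β (ψ x) (secondFF G H ψ x u v) (fderiv ℝ ψ x (bvec j)) = 0 := by
    intro j
    -- The Koszul formula is available only against coordinate vectors. Expanding each derivative of
    -- the metric by compatibility and symmetrizing by torsion-freeness, all terms cancel.
    rw [secondFF, confMetric_sub_left, h.confMetric_fderiv_christoffel hx, h.fderiv_metric hx,
      h.fderiv_metric hx, h.fderiv_metric hx, h.covAlong_comm hx v u, h.covAlong_comm hx (bvec j) u,
      h.covAlong_comm hx (bvec j) v,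
      confMetric_comm _ (fderiv ℝ ψ x v), confMetric_comm _ (fderiv ℝ ψ x u)]
    ring
  rw [← inner_bvec_smul_sum w, map_sum, confMetric_comm, confMetric_sum_left]
  refine Finset.sum_eq_zero fun i _ => ?_
  rw [map_smul, confMetric_smul_left, confMetric_comm, hj, mul_zero]

end IsConfImmersion

/-! ### Totally umbilical hypersurfaces -/

/-- A differentiable family of injective linear maps has, locally, a differentiable nonvanishing
normal field. -/
lemma exists_normal_field {n : ℕ} {L : Euc n → Euc n →L[ℝ] Euc (n + 1)} {x : Euc n}
    (hL : ContDiffAt ℝ 1 L x) (hinj : Function.Injective (L x)) :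
    ∃ N : Euc n → Euc (n + 1), ∀ᶠ y in 𝓝 x,
      DifferentiableAt ℝ N y ∧ N y ≠ 0 ∧ ∀ v, ⟪N y, L y v⟫ = 0 := by
  obtain ⟨ξ, hξ, hξL⟩ := exists_ne_zero_orthogonal_range (L x).toLinearMap
  let adj : (Euc n →L[ℝ] Euc (n + 1)) →L[ℝ] Euc (n + 1) →L[ℝ] Euc n :=
    { toFun := fun T => ContinuousLinearMap.adjoint T
      map_add' := fun S T => map_add _ S T
      map_smul' := fun r T => by simp
      cont := (ContinuousLinearMap.adjoint (𝕜 := ℝ) (E := Euc n) (F := Euc (n + 1))).continuous }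
  -- Fix ξ normal to the range of L x. The map w ↦ (L(y)* w, ⟨ξ, w⟩) is invertible at x, hence
  -- nearby, and the preimage of (0, 1) is orthogonal to the range of L(y), nonzero, and as regular
  -- in y as L.
  let A : Euc n → Euc (n + 1) →L[ℝ] Euc n × ℝ :=
    fun y => (ContinuousLinearMap.inl ℝ (Euc n) ℝ).comp (adj (L y))
      + (ContinuousLinearMap.inr ℝ (Euc n) ℝ).comp (innerSL ℝ ξ)
  have hA1 : ∀ y w, (A y w).1 = ContinuousLinearMap.adjoint (L y) w := fun y w => by simp [A, adj]
  have hA2 : ∀ y w, (A y w).2 = ⟪ξ, w⟫ := fun y w => by simp [A, adj]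
  have hAx : ContDiffAt ℝ 1 A x :=
    (contDiffAt_const.clm_comp (adj.contDiff.contDiffAt.comp x hL)).add contDiffAt_const
  have hAinj : Function.Injective (A x) := by
    rw [injective_iff_map_eq_zero]
    intro w hw
    have h1 : ContinuousLinearMap.adjoint (L x) w = 0 := by rw [← hA1, hw]; rfl
    have h2 : ⟪ξ, w⟫ = 0 := by rw [← hA2 x, hw]; rfl
    obtain ⟨c, hc⟩ := exists_smul_of_orthogonal_range (L := (L x).toLinearMap) hinj hξ hξL
      (b := w) (fun v => by
        have := ContinuousLinearMap.adjoint_inner_left (L x) v w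
        rw [h1, inner_zero_left] at this
        exact this.symm)
    rw [hc, inner_smul_right] at h2
    rcases mul_eq_zero.1 h2 with h3 | h3
    · rw [hc, h3, zero_smul]
    · exact absurd (inner_self_eq_zero.1 h3) hξ
  let e : Euc (n + 1) ≃L[ℝ] Euc n × ℝ :=
    (LinearMap.linearEquivOfInjective (A x).toLinearMap hAinj (by simp)).toContinuousLinearEquiv
  have he : (e : Euc (n + 1) →L[ℝ] Euc n × ℝ) = A x := by
    ext1 w
    rfl
  have hN : ContDiffAt ℝ 1 (fun y => (A y).inverse (0, 1)) x := by
    have h1 : ContDiffAt ℝ 1 ContinuousLinearMap.inverse (A x) := he ▸ contDiffAt_map_inverse e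
    exact (h1.comp x hAx).clm_apply contDiffAt_const
  refine ⟨fun y => (A y).inverse (0, 1), ?_⟩
  have hnear : ∀ᶠ y in 𝓝 x, A y ∈ Set.range ((↑) : (Euc (n + 1) ≃L[ℝ] Euc n × ℝ) → _) :=
    hAx.continuousAt.eventually_mem (he ▸ ContinuousLinearEquiv.nhds e)
  filter_upwards [hnear, hN.eventually (by simp)] with y ⟨e', he'⟩ hy
  have hAN : A y ((A y).inverse (0, 1)) = (0, 1) := by
    rw [← he', ContinuousLinearMap.inverse_equiv]
    exact e'.apply_symm_apply _
  refine ⟨hy.differentiableAt (by norm_num), fun h0 => ?_, fun v => ?_⟩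
  · rw [h0, map_zero] at hAN
    exact zero_ne_one (congrArg Prod.snd hAN)
  · have h1 : ContinuousLinearMap.adjoint (L y) ((A y).inverse (0, 1)) = 0 := by
      rw [← hA1, hAN]
    rw [← ContinuousLinearMap.adjoint_inner_left, h1, inner_zero_left]

namespace IsConfImmersion

variable {n : ℕ} {α β : ℝ} {U : Set (Euc n)} {ψ : Euc n → Euc (n + 1)}
  {G : Euc n → Euc n → Euc n → ℝ} {H : Euc (n + 1) → Euc (n + 1) → Euc (n + 1) → ℝ} {x : Euc n}

lemma exists_unit_normal (h : IsConfImmersion α β U ψ G H) (hx : x ∈ U) :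
    ∃ N : Euc n → Euc (n + 1), ∀ᶠ y in 𝓝 x, DifferentiableAt ℝ N y ∧
      confMetric α β (ψ y) (N y) (N y) = 1 ∧
      ∀ v, confMetric α β (ψ y) (N y) (fderiv ℝ ψ y v) = 0 := by
  obtain ⟨N, hN⟩ := exists_normal_field ((h.contDiffAt_fderiv hx).of_le (by norm_num))
    (h.fderiv_injective hx)
  refine ⟨fun y => (confFactor α β (ψ y) * ‖N y‖⁻¹) • N y, ?_⟩
  filter_upwards [hN, h.mem_nhds hx] with y ⟨hd, h0, hv⟩ hy
  have hF := h.factor_ne y hy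
  have hp := h.differentiableAt hy
  have h1 : DifferentiableAt ℝ (fun z => confFactor α β (ψ z)) y :=
    ((hp.inner ℝ hp).const_mul β).const_add α
  refine ⟨(h1.mul ((hd.norm ℝ h0).inv (norm_ne_zero_iff.2 h0))).smul hd, ?_, fun v => ?_⟩
  · have : ‖N y‖ ≠ 0 := norm_ne_zero_iff.2 h0
    rw [confMetric_smul_left, confMetric_smul_right, confMetric, real_inner_self_eq_norm_sq]
    field_simp
  · rw [confMetric_smul_left, (confMetric_eq_zero_iff hF _ _).2 (hv v), mul_zero]

lemma exists_smul_of_normal (h : IsConfImmersion α β U ψ G H) (hx : x ∈ U) {a b : Euc (n + 1)}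
    (ha : confMetric α β (ψ x) a a = 1) (haψ : ∀ v, confMetric α β (ψ x) a (fderiv ℝ ψ x v) = 0)
    (hbψ : ∀ v, confMetric α β (ψ x) b (fderiv ℝ ψ x v) = 0) :
    b = confMetric α β (ψ x) b a • a := by
  have hF := h.factor_ne x hx
  obtain ⟨c, rfl⟩ := exists_smul_of_orthogonal_range (L := (fderiv ℝ ψ x).toLinearMap) (a := a)
    (b := b) (h.fderiv_injective hx) (by rintro rfl; simp [confMetric] at ha)
    (fun v => (confMetric_eq_zero_iff hF _ _).1 (haψ v))
    (fun v => (confMetric_eq_zero_iff hF _ _).1 (hbψ v))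
  rw [confMetric_smul_left, ha, mul_one]

/-- A linear form on a space of dimension at least 2 has a nontrivial kernel. Codazzi's equation
needs this orthogonal direction. -/
lemma exists_ne_zero_metric_eq_zero (hn : 2 ≤ n) (h : IsConfImmersion α β U ψ G H) (hx : x ∈ U)
    (w : Euc n) : ∃ u, u ≠ 0 ∧ G x w u = 0 := by
  let T : Euc n →ₗ[ℝ] ℝ :=
    { toFun := fun u => G x w u
      map_add' := fun u v => by
        simp only [h.pullback x hx, map_add, confMetric_add_right]
      map_smul' := fun r v => by
        simp only [h.pullback x hx, map_smul, confMetric_smul_right, smul_eq_mul, RingHom.id_apply] }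
  have : LinearMap.ker T ≠ ⊥ := by
    refine LinearMap.ker_ne_bot_of_finrank_lt ?_
    simp
    omega
  obtain ⟨u, hu, hu0⟩ := Submodule.exists_mem_ne_zero_of_ne_bot this
  exact ⟨u, hu0, hu⟩

/-- Near every point, a totally umbilical hypersurface of a space form has a unit normal field `N`
and a constant mean curvature `c`: the second fundamental form is `c G N`, and `∇ N = -c dψ`. -/
theorem exists_normal_of_umbilical (hn : 2 ≤ n) (h : IsConfImmersion α β U ψ G H)
    (humb : ∀ y ∈ U, ∀ u v, secondFF G H ψ y u v
      = G y u v • ((1 / (n : ℝ)) • tension G H ψ y)) (hx : x ∈ U) :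
    ∃ (N : Euc n → Euc (n + 1)) (c : ℝ), ∀ᶠ y in 𝓝 x, DifferentiableAt ℝ N y ∧
      confMetric α β (ψ y) (N y) (N y) = 1 ∧
      (∀ v, confMetric α β (ψ y) (N y) (fderiv ℝ ψ y v) = 0) ∧
      (∀ u, covAlong H ψ N y u = -c • fderiv ℝ ψ y u) ∧
      tension G H ψ y = (n * c) • N y := by
  have hn0 : (n : ℝ) ≠ 0 := by positivity
  obtain ⟨N, hN⟩ := h.exists_unit_normal hx
  -- Only a nonzero vector is wanted here, so the orthogonality condition is made trivial. Defining
  -- c by the single direction u₀, instead of by the trace, makes its differentiability immediate.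
  obtain ⟨u₀, hu₀, -⟩ := h.exists_ne_zero_metric_eq_zero hn hx 0
  set c : Euc n → ℝ := fun y =>
    confMetric α β (ψ y) (covAlong H ψ (fun z => fderiv ℝ ψ z u₀) y u₀) (N y) / G y u₀ u₀ with hc
  have hB : ∀ᶠ y in 𝓝 x, (∀ u v, confMetric α β (ψ y) (covAlong H ψ (fun z => fderiv ℝ ψ z v) y u)
      (N y) = c y * G y u v) ∧ tension G H ψ y = (n * c y) • N y := by
    filter_upwards [hN, h.mem_nhds hx] with y ⟨_, h1, h2⟩ hy
    have hG0 := h.pos y hy u₀ hu₀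
    have hcov : ∀ u v, confMetric α β (ψ y) (covAlong H ψ (fun z => fderiv ℝ ψ z v) y u) (N y)
        = confMetric α β (ψ y) ((1 / (n : ℝ)) • tension G H ψ y) (N y) * G y u v := by
      intro u v
      have h3 : covAlong H ψ (fun z => fderiv ℝ ψ z v) y u = secondFF G H ψ y u v
          + fderiv ℝ ψ y (christoffel G y u v) := by rw [secondFF, sub_add_cancel]
      rw [h3, confMetric_add_left, confMetric_comm _ (fderiv ℝ ψ y _), h2, add_zero, humb y hy,
        confMetric_smul_left, mul_comm]
    have hcy : c y = confMetric α β (ψ y) ((1 / (n : ℝ)) • tension G H ψ y) (N y) := by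
      rw [hc]
      simp only [hcov]
      field_simp
    refine ⟨fun u v => by rw [hcov, hcy], ?_⟩
    have h4 := h.exists_smul_of_normal hy h1 h2 (b := (1 / (n : ℝ)) • tension G H ψ y) (fun v => by
      have h5 := h.confMetric_secondFF hy u₀ u₀ v
      rw [humb y hy, confMetric_smul_left] at h5
      exact (mul_eq_zero.1 h5).resolve_left hG0.ne')
    rw [← hcy] at h4
    rw [mul_smul, ← h4, smul_smul]
    field_simp
    rw [one_smul]
  -- Weingarten: differentiating ⟨N, N⟩ = 1 kills the normal component of ∇N, and differentiating
  -- ⟨N, dψ(v)⟩ = 0 gives the tangential one.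
  have hDN : ∀ᶠ y in 𝓝 x, ∀ w, covAlong H ψ N y w = -c y • fderiv ℝ ψ y w := by
    filter_upwards [hN.eventually_nhds, hB, h.mem_nhds hx] with y hNy ⟨h3, _⟩ hy w
    obtain ⟨h0, h1, h2⟩ := hNy.self_of_nhds
    have hNN : confMetric α β (ψ y) (covAlong H ψ N y w) (N y) = 0 := by
      have e1 : (fun z => confMetric α β (ψ z) (N z) (N z)) =ᶠ[𝓝 y] fun _ => 1 :=
        hNy.mono fun z hz => hz.2.1
      have e2 := h.fderiv_confMetric hy h0 h0 w
      rw [e1.fderiv_eq, confMetric_comm _ (N y)] at e2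
      simp at e2
      linarith
    have hNv : ∀ v, confMetric α β (ψ y) (covAlong H ψ N y w) (fderiv ℝ ψ y v) = -(c y * G y w v) := by
      intro v
      have e1 : (fun z => confMetric α β (ψ z) (N z) (fderiv ℝ ψ z v)) =ᶠ[𝓝 y] fun _ => 0 :=
        hNy.mono fun z hz => hz.2.2 v
      have e2 := h.fderiv_confMetric hy h0 (h.differentiableAt_fderiv_apply hy v) w
      rw [e1.fderiv_eq, confMetric_comm _ (N y), h3] at e2
      simp at e2
      linarith
    have h5 := h.exists_smul_of_normal hy h1 h2 (b := covAlong H ψ N y w + c y • fderiv ℝ ψ y w)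
      (fun v => by
        rw [confMetric_add_left, hNv, confMetric_smul_left, ← h.pullback y hy]
        ring)
    rw [confMetric_add_left, hNN, confMetric_smul_left, confMetric_comm _ _ (N y), h2] at h5
    rw [neg_smul, eq_neg_iff_add_eq_zero, h5]
    simp
  have hdc : ∀ᶠ y in 𝓝 x, DifferentiableAt ℝ c y := by
    filter_upwards [hN, h.mem_nhds hx] with y ⟨h0, _, _⟩ hy
    exact (h.differentiableAt_confMetric hy
      (h.differentiableAt_covAlong hy (h.contDiffAt_fderiv_apply hy u₀) u₀) h0).fun_mul
      ((h.differentiableAt_metric hy u₀ u₀).fun_inv (h.pos y hy u₀ hu₀).ne')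
  -- the Codazzi equation
  have hdc0 : ∀ᶠ y in 𝓝 x, fderiv ℝ c y = 0 := by
    filter_upwards [hN, hB.eventually_nhds, hDN, hdc, h.mem_nhds hx]
      with y ⟨h0, h1, h2⟩ hBy h4 h5 hy
    -- Both sides come from differentiating ⟨∇_u dψ(v), N⟩ = c g(u,v) in the direction w. Exchanging
    -- u and w and subtracting leaves a curvature term, which is tangential and so invisible to N.
    have key : ∀ u v w, fderiv ℝ c y w * G y u v + c y * fderiv ℝ (fun z => G z u v) y w
        = confMetric α β (ψ y) (covAlong H ψ (fun z => covAlong H ψ (fun z => fderiv ℝ ψ z v) z u) y w)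
            (N y)
          - c y * confMetric α β (ψ y) (covAlong H ψ (fun z => fderiv ℝ ψ z v) y u)
            (fderiv ℝ ψ y w) := by
      intro u v w
      have e1 : (fun z => confMetric α β (ψ z) (covAlong H ψ (fun z => fderiv ℝ ψ z v) z u) (N z))
          =ᶠ[𝓝 y] fun z => c z * G z u v := hBy.mono fun z hz => hz.1 u v
      have e2 := h.fderiv_confMetric hy
        (h.differentiableAt_covAlong hy (h.contDiffAt_fderiv_apply hy v) u) h0 w
      rw [e1.fderiv_eq, fderiv_fun_mul h5 (h.differentiableAt_metric hy u v), h4,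
        confMetric_smul_right] at e2
      simp only [add_apply, smul_apply, smul_eq_mul] at e2
      linarith
    have codazzi : ∀ u v w, fderiv ℝ c y w * G y u v = fderiv ℝ c y u * G y w v := by
      intro u v w
      have k1 := key u v w
      have k2 := key w v u
      have k3 := congrArg (fun a => confMetric α β (ψ y) a (N y))
        (h.covAlong_covAlong_sub hy (h.contDiffAt_fderiv_apply hy v) u w)
      simp only [confMetric_comm _ _ (N y), confMetric_sub_right, confMetric_smul_right, h2] at k3
      rw [h.fderiv_metric hy] at k1 k2
      rw [h.covAlong_comm hy u w] at k2
      simp only [confMetric_comm _ _ (N y)] at k1 k2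
      rw [confMetric_comm _ (fderiv ℝ ψ y u)] at k1
      rw [confMetric_comm _ (fderiv ℝ ψ y w)] at k2
      linarith
    ext w
    obtain ⟨u, hu0, hu⟩ := h.exists_ne_zero_metric_eq_zero hn hy w
    have := codazzi u u w
    rw [hu, mul_zero] at this
    simpa using (mul_eq_zero.1 this).resolve_right (h.pos y hy u hu0).ne'
  have hcc := eventually_eq_of_fderiv_eq_zero (hdc.and hdc0)
  refine ⟨N, c x, ?_⟩
  filter_upwards [hN, hB, hDN, hcc] with y ⟨a1, a2, a3⟩ ⟨_, a4⟩ a5 a6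
  rw [a6] at a5 a4
  exact ⟨a1, a2, a3, a5, a4⟩

end IsConfImmersion

/-! ### The `f`-biharmonic equation for totally umbilical hypersurfaces -/

lemma traceG_smul {n : ℕ} {F : Type*} [AddCommGroup F] [Module ℝ F] (G : Euc n → Euc n → Euc n → ℝ)
    (x : Euc n) (B : Euc n → Euc n → F) (r : ℝ) :
    traceG G x (fun u v => r • B u v) = r • traceG G x B := by
  simp only [traceG, Finset.smul_sum, smul_comm r]

namespace IsConfImmersion

section

variable {n k : ℕ} {α β : ℝ} {U : Set (Euc n)} {ψ : Euc n → Euc k}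
  {G : Euc n → Euc n → Euc n → ℝ} {H : Euc k → Euc k → Euc k → ℝ} {x : Euc n}

lemma traceG_metric_smul (h : IsConfImmersion α β U ψ G H) (hx : x ∈ U) {F : Type*}
    [AddCommGroup F] [Module ℝ F] (a : F) :
    traceG G x (fun u v => G x u v • a) = (n : ℝ) • a := by
  simp only [traceG, smul_smul]
  rw [Finset.sum_comm]
  have : ∀ j, ∑ i, (invGram G x i j * G x (bvec i) (bvec j)) • a = (1 : ℝ) • a := by
    intro j
    rw [← Finset.sum_smul, ← Matrix.one_apply_eq (α := ℝ) j, ← h.sum_gram_mul_invGram hx]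
    congr 1
    exact Finset.sum_congr rfl fun i _ => by rw [mul_comm, h.metric_comm hx]
  rw [Finset.sum_congr rfl fun j _ => this j]
  simp [← Nat.cast_smul_eq_nsmul ℝ]

lemma fderiv_eq_zero_of_gradG_eq_zero (h : IsConfImmersion α β U ψ G H) (hx : x ∈ U) {f : Euc n → ℝ}
    (hf : gradG G f x = 0) : fderiv ℝ f x = 0 := by
  have h1 : (invGram G x).mulVec (fun j => fderiv ℝ f x (bvec j)) = 0 := by
    funext i
    have h2 := congrArg (fun b : Euc n => b i) hf
    simpa [gradG, ← Finset.sum_smul, bvec, Finset.sum_apply, Pi.single_apply, Matrix.mulVec,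
      dotProduct] using h2
  have h3 : (fun j => fderiv ℝ f x (bvec j)) = 0 := by
    rw [← Matrix.one_mulVec (fun j => fderiv ℝ f x (bvec j)), ← h.gram_mul_invGram hx,
      ← Matrix.mulVec_mulVec, h1, Matrix.mulVec_zero]
  ext v
  rw [← inner_bvec_smul_sum v, map_sum]
  exact Finset.sum_eq_zero fun i _ => by rw [map_smul, congrFun h3 i]; simp

end

variable {n : ℕ} {α β : ℝ} {U : Set (Euc n)} {ψ : Euc n → Euc (n + 1)}
  {G : Euc n → Euc n → Euc n → ℝ} {H : Euc (n + 1) → Euc (n + 1) → Euc (n + 1) → ℝ} {x : Euc n}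

/-- Since c is constant, ∇τ = -nc² dψ, so the rough Laplacian of τ is -nc² times the trace of ∇dψ,
that is, a multiple of τ itself. The curvature trace contributes n²Kc N, and the only tangential
term comes from ∇τ along grad f. -/
lemma fBitension_eq (h : IsConfImmersion α β U ψ G H) (hx : x ∈ U) (f : Euc n → ℝ)
    {N : Euc n → Euc (n + 1)} {c : ℝ}
    (hN : ∀ᶠ y in 𝓝 x, DifferentiableAt ℝ N y ∧
      confMetric α β (ψ y) (N y) (N y) = 1 ∧
      (∀ v, confMetric α β (ψ y) (N y) (fderiv ℝ ψ y v) = 0) ∧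
      (∀ u, covAlong H ψ N y u = -c • fderiv ℝ ψ y u) ∧
      tension G H ψ y = (n * c) • N y) :
    fBitension G H ψ f x
      = (n * c * (n * f x * (4 * α * β - c ^ 2) + laplaceG G f x)) • N x
        - (2 * n * c ^ 2) • fderiv ℝ ψ x (gradG G f x) := by
  have hT : ∀ᶠ y in 𝓝 x, ∀ v, covAlong H ψ (tension G H ψ) y v
      = (-(n * c ^ 2)) • fderiv ℝ ψ y v := by
    filter_upwards [hN.eventually_nhds, h.mem_nhds hx] with y hy hyU v
    have e : tension G H ψ =ᶠ[𝓝 y] fun z => (n * c) • N z := hy.mono fun z hz => hz.2.2.2.2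
    obtain ⟨h0, -, -, h1, -⟩ := hy.self_of_nhds
    rw [covAlong_congr e, h.covAlong_smul hyU h0, h1, smul_smul]
    congr 1
    ring
  obtain ⟨-, -, hNψ, -, hTx⟩ := hN.self_of_nhds
  have h1 : (fun u v => covAlong H ψ (fun y => covAlong H ψ (tension G H ψ) y v) x u
        - covAlong H ψ (tension G H ψ) x (christoffel G x u v))
      = fun u v => (-(n * c ^ 2)) • secondFF G H ψ x u v := by
    funext u v
    have e : (fun y => covAlong H ψ (tension G H ψ) y v)
        =ᶠ[𝓝 x] fun y => (-(n * c ^ 2)) • fderiv ℝ ψ y v := hT.mono fun z hz => hz v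
    rw [covAlong_congr e, h.covAlong_smul hx (h.differentiableAt_fderiv_apply hx v),
      hT.self_of_nhds, secondFF, smul_sub]
  have h2 : (fun u v => curvature H (ψ x) (fderiv ℝ ψ x u) (tension G H ψ x) (fderiv ℝ ψ x v))
      = fun u v => G x u v • (-(4 * α * β) * (n * c)) • N x := by
    funext u v
    rw [curvature_congr (h.target x hx), curvature_confMetric (h.factor_ne x hx), hTx,
      confMetric_smul_left, hNψ, ← h.pullback x hx]
    module
  rw [fBitension, bitension, h1, h2, traceG_smul, h.traceG_metric_smul hx, hT.self_of_nhds]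
  -- The trace of the second fundamental form is the tension field by definition.
  change f x • (_ • tension G H ψ x - _) + _ + _ = _
  rw [hTx]
  module

/-- The mean curvature of a totally umbilical `f`-biharmonic hypersurface is `0`, or its square is
the sectional curvature of the ambient space. -/
theorem mean_curvature_of_fBiharmonic (hn : n ≠ 0) (h : IsConfImmersion α β U ψ G H) (hx : x ∈ U)
    {f : Euc n → ℝ} (hf : ∀ y ∈ U, f y ≠ 0) (hbih : ∀ y ∈ U, fBitension G H ψ f y = 0)
    {N : Euc n → Euc (n + 1)} {c : ℝ}
    (hN : ∀ᶠ y in 𝓝 x, DifferentiableAt ℝ N y ∧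
      confMetric α β (ψ y) (N y) (N y) = 1 ∧
      (∀ v, confMetric α β (ψ y) (N y) (fderiv ℝ ψ y v) = 0) ∧
      (∀ u, covAlong H ψ N y u = -c • fderiv ℝ ψ y u) ∧
      tension G H ψ y = (n * c) • N y) :
    c = 0 ∨ c ^ 2 = 4 * α * β := by
  by_cases hc : c = 0
  · exact Or.inl hc
  right
  have hn' : (n : ℝ) ≠ 0 := Nat.cast_ne_zero.2 hn
  -- Pairing with N isolates the normal equation; what remains says dψ(grad f) = 0, and dψ is
  -- injective. Having this on a whole neighbourhood is what makes the Laplacian vanish at x.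
  have key : ∀ᶠ y in 𝓝 x, n * f y * (4 * α * β - c ^ 2) + laplaceG G f y = 0 ∧
      fderiv ℝ f y = 0 := by
    filter_upwards [hN.eventually_nhds, h.mem_nhds hx] with y hNy hy
    have e := h.fBitension_eq hy f hNy
    rw [hbih y hy] at e
    obtain ⟨-, h1, h2, -, -⟩ := hNy.self_of_nhds
    have e1 := congrArg (confMetric α β (ψ y) (N y)) e
    rw [confMetric_sub_right, confMetric_smul_right, confMetric_smul_right, h1, h2,
      confMetric_comm, confMetric_zero_left, mul_one, mul_zero, sub_zero, eq_comm] at e1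
    have e2 := (mul_eq_zero.1 e1).resolve_left (mul_ne_zero hn' hc)
    refine ⟨e2, h.fderiv_eq_zero_of_gradG_eq_zero hy ?_⟩
    rw [e2, mul_zero, zero_smul, zero_sub, eq_comm, neg_eq_zero] at e
    have e3 := (smul_eq_zero.1 e).resolve_left (by positivity)
    exact (injective_iff_map_eq_zero _).1 (h.fderiv_injective hy) _ e3
  obtain ⟨k1, k2⟩ := key.self_of_nhds
  have k3 : laplaceG G f x = 0 := by
    have : ∀ v, fderiv ℝ (fun y => fderiv ℝ f y v) x = 0 := fun v => by
      have e : (fun y => fderiv ℝ f y v) =ᶠ[𝓝 x] fun _ => 0 :=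
        key.mono fun y hy => by simp [hy.2]
      rw [e.fderiv_eq]
      simp
    simp [laplaceG, traceG, this, k2]
  rw [k3, add_zero] at k1
  have := (mul_eq_zero.1 k1).resolve_left (mul_ne_zero hn' (hf x hx))
  linarith

/-- Totally umbilical `f`-biharmonic hypersurfaces of flat or negatively curved space forms are
totally geodesic. -/
theorem secondFF_eq_zero (hn : 2 ≤ n) (h : IsConfImmersion α β U ψ G H) (hx : x ∈ U)
    (hK : 4 * α * β ≤ 0)
    (humb : ∀ y ∈ U, ∀ u v, secondFF G H ψ y u v = G y u v • ((1 / (n : ℝ)) • tension G H ψ y))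
    {f : Euc n → ℝ} (hf : ∀ y ∈ U, f y ≠ 0) (hbih : ∀ y ∈ U, fBitension G H ψ f y = 0)
    (u v : Euc n) : secondFF G H ψ x u v = 0 := by
  obtain ⟨N, c, hN⟩ := h.exists_normal_of_umbilical hn humb hx
  have hc : c = 0 := by
    rcases h.mean_curvature_of_fBiharmonic (by omega) hx hf hbih hN with hc | hc
    · exact hc
    · exact pow_eq_zero_iff two_ne_zero |>.1 (le_antisymm (hc ▸ hK) (sq_nonneg c))
  rw [humb x hx, hN.self_of_nhds.2.2.2.2, hc]
  simp

end IsConfImmersion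

/-! ### From manifolds to charts -/

/-- The part of the target of the chart `e` where `φ` can be read in the chart `e'`. -/
def chartDomain {m n : ℕ} {M N : Type*} [TopologicalSpace M] [TopologicalSpace N] (φ : M → N) (e : OpenPartialHomeomorph M (Euc m))
    (e' : OpenPartialHomeomorph N (Euc n)) : Set (Euc m) :=
  e.target ∩ e.symm ⁻¹' (φ ⁻¹' e'.source)

lemma mem_chartDomain {m n : ℕ} {M N : Type*} [TopologicalSpace M] [TopologicalSpace N] {φ : M → N} {e : OpenPartialHomeomorph M (Euc m)}
    {e' : OpenPartialHomeomorph N (Euc n)} {p : M} (hp : p ∈ e.source) (hp' : φ p ∈ e'.source) :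
    e p ∈ chartDomain φ e e' :=
  ⟨e.map_source hp, by simpa [e.left_inv hp] using hp'⟩

section Charts

variable {m n : ℕ} {M N : Type*} [TopologicalSpace M] [ChartedSpace (Euc m) M]
  [TopologicalSpace N] [ChartedSpace (Euc n) N]

/-- The passage from the manifold hypotheses to the coordinate setting: the chain rule turns φ^*h =
g into the pull-back identity, and positivity of g survives because the differential of a chart is
injective. -/
lemma isConfImmersion_chart [IsManifold (𝓡 m) ∞ M] [IsManifold (𝓡 n) ∞ N] {α β : ℝ}
    {g : Bundle.ContMDiffRiemannianMetric (𝓡 m) ∞ (Euc m) (fun p : M => TangentSpace (𝓡 m) p)}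
    {h : MetricTensor n N} {φ : M → N} (hφ : IsIsometricImmersion (metricOf g) h φ)
    {e : OpenPartialHomeomorph M (Euc m)} (he : e ∈ atlas (Euc m) M)
    {e' : OpenPartialHomeomorph N (Euc n)} (he' : e' ∈ atlas (Euc n) N)
    (hconf : ∀ y ∈ e'.target, confFactor α β y ≠ 0 ∧
      metricInChart h e' y = confMetric α β y) :
    IsConfImmersion α β (chartDomain φ e e') (e' ∘ φ ∘ e.symm) (metricInChart (metricOf g) e)
      (metricInChart h e') := by
  have hopen : IsOpen (chartDomain φ e e') :=
    e.isOpen_inter_preimage_symm (e'.open_source.preimage hφ.1.continuous)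
  have heM := IsManifold.subset_maximalAtlas (I := 𝓡 m) (n := ∞) he
  have heN := IsManifold.subset_maximalAtlas (I := 𝓡 n) (n := ∞) he'
  have hes : ∀ x ∈ chartDomain φ e e', ContMDiffAt (𝓡 m) (𝓡 m) ∞ e.symm x := fun x hx =>
    (contMDiffOn_symm_of_mem_maximalAtlas heM).contMDiffAt (e.open_target.mem_nhds hx.1)
  have hφe : ∀ x ∈ chartDomain φ e e', ContMDiffAt (𝓡 m) (𝓡 n) ∞ (φ ∘ e.symm) x := fun x hx =>
    (hφ.1 (e.symm x)).comp x (hes x hx)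
  have hψ : ∀ x ∈ chartDomain φ e e', ContMDiffAt (𝓡 m) (𝓡 n) ∞ (e' ∘ φ ∘ e.symm) x := fun x hx =>
    ((contMDiffOn_of_mem_maximalAtlas heN).contMDiffAt
      (e'.open_source.mem_nhds hx.2)).comp x (hφe x hx)
  have hmem : ∀ x ∈ chartDomain φ e e', (e' ∘ φ ∘ e.symm) x ∈ e'.target := fun x hx =>
    e'.map_source hx.2
  have hinj : ∀ x ∈ chartDomain φ e e', ∀ u : Euc m, mfderiv (𝓡 m) (𝓡 m) e.symm x u = 0 →
      u = 0 := by
    intro x hx u hu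
    have h1 := (mdifferentiable_of_mem_atlas (I := 𝓡 m) he).comp_symm_deriv hx.1
    have h2 : mfderiv (𝓡 m) (𝓡 m) e (e.symm x) (mfderiv (𝓡 m) (𝓡 m) e.symm x u) = u :=
      DFunLike.congr_fun h1 u
    exact h2.symm.trans ((congrArg (mfderiv (𝓡 m) (𝓡 m) e (e.symm x)) hu).trans (map_zero _))
  have hchain : ∀ x ∈ chartDomain φ e e', ∀ u : Euc m,
      mfderiv (𝓡 n) (𝓡 n) e'.symm ((e' ∘ φ ∘ e.symm) x) (fderiv ℝ (e' ∘ φ ∘ e.symm) x u)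
        = mfderiv (𝓡 m) (𝓡 n) φ (e.symm x) (mfderiv (𝓡 m) (𝓡 m) e.symm x u) := by
    intro x hx u
    have d1 : MDifferentiableAt (𝓡 n) (𝓡 n) e'.symm ((e' ∘ φ ∘ e.symm) x) :=
      ((contMDiffOn_symm_of_mem_maximalAtlas heN).contMDiffAt
        (e'.open_target.mem_nhds (hmem x hx))).mdifferentiableAt (by simp)
    have d2 := (hψ x hx).mdifferentiableAt (by simp)
    have d3 := (hφ.1 (e.symm x)).mdifferentiableAt (by simp)
    have d4 := (hes x hx).mdifferentiableAt (by simp)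
    have ev : e'.symm ∘ (e' ∘ φ ∘ e.symm) =ᶠ[𝓝 x] φ ∘ e.symm := by
      filter_upwards [hopen.mem_nhds hx] with y hy
      exact e'.left_inv hy.2
    have c1 := mfderiv_comp x d1 d2
    have c2 := mfderiv_comp x d3 d4
    rw [ev.mfderiv_eq, c2, mfderiv_eq_fderiv] at c1
    exact (congrArg (fun T : Euc m →L[ℝ] Euc n => T u) c1).symm
  refine ⟨hopen, fun x hx => (hψ x hx).contDiffAt, fun x hx => (hconf _ (hmem x hx)).1,
    fun x hx => ?_, fun x hx u v => ?_, fun x hx u hu => ?_⟩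
  · filter_upwards [e'.open_target.mem_nhds (hmem x hx)] with y hy using (hconf y hy).2
  · rw [← (hconf _ (hmem x hx)).2]
    have e1 : e'.symm ((e' ∘ φ ∘ e.symm) x) = φ (e.symm x) := e'.left_inv hx.2
    have e2 := hφ.2 (e.symm x) (mfderiv (𝓡 m) (𝓡 m) e.symm x u) (mfderiv (𝓡 m) (𝓡 m) e.symm x v)
    -- The base point cannot be rewritten directly because the type of the tangent vectors depends
    -- on it; viewing every fibre as `Euc n` allows the substitution.
    have e3 : ∀ p q : N, p = q → ∀ a b : Euc n,
        (h p : Euc n → Euc n → ℝ) a b = (h q : Euc n → Euc n → ℝ) a b := by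
      rintro p _ rfl a b; rfl
    exact e2.symm.trans ((e3 _ _ e1 _ _).trans (congrArg₂ (h (φ (e.symm x)) : Euc n → Euc n → ℝ)
      (hchain x hx u) (hchain x hx v))).symm
  · exact g.pos (e.symm x) _ fun h0 => hu (hinj x hx u h0)

lemma secondFF_umbilical_chart {g : MetricTensor m M} {h : MetricTensor n N} {φ : M → N}
    (humb : IsTotallyUmbilical g h φ)
    {e : OpenPartialHomeomorph M (Euc m)} (he : e ∈ atlas (Euc m) M)
    {e' : OpenPartialHomeomorph N (Euc n)} (he' : e' ∈ atlas (Euc n) N) :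
    ∀ y ∈ chartDomain φ e e', ∀ u v,
      secondFF (metricInChart g e) (metricInChart h e') (e' ∘ φ ∘ e.symm) y u v
        = metricInChart g e y u v • ((1 / (m : ℝ)) •
          tension (metricInChart g e) (metricInChart h e') (e' ∘ φ ∘ e.symm) y) := by
  intro y hy u v
  have := humb e he e' he' (e.symm y) (e.map_target hy.1) hy.2 u v
  rwa [e.right_inv hy.1] at this

lemma fBitension_chart {g : MetricTensor m M} {h : MetricTensor n N} {φ : M → N} {f : M → ℝ}
    (hf : IsFBiharmonicMap g h φ f)
    {e : OpenPartialHomeomorph M (Euc m)} (he : e ∈ atlas (Euc m) M)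
    {e' : OpenPartialHomeomorph N (Euc n)} (he' : e' ∈ atlas (Euc n) N) :
    ∀ y ∈ chartDomain φ e e', fBitension (metricInChart g e) (metricInChart h e')
      (e' ∘ φ ∘ e.symm) (f ∘ e.symm) y = 0 := by
  intro y hy
  have := hf e he e' he' (e.symm y) (e.map_target hy.1) hy.2
  rwa [e.right_inv hy.1] at this

end Charts

theorem isTotallyGeodesic_of_nonpos_curvature {m : ℕ} (hm : 2 ≤ m) {M N : Type*}
    [TopologicalSpace M] [ChartedSpace (Euc m) M] [IsManifold (𝓡 m) ∞ M] [TopologicalSpace N]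
    [ChartedSpace (Euc (m + 1)) N] [IsManifold (𝓡 (m + 1)) ∞ N]
    (g : Bundle.ContMDiffRiemannianMetric (𝓡 m) ∞ (Euc m) (fun p : M => TangentSpace (𝓡 m) p))
    {h : MetricTensor (m + 1) N} {α β : ℝ} (hK : 4 * α * β ≤ 0)
    (hconf : ∀ e' ∈ atlas (Euc (m + 1)) N, ∀ y ∈ e'.target, confFactor α β y ≠ 0 ∧
      metricInChart h e' y = confMetric α β y)
    {φ : M → N} (hφ : IsIsometricImmersion (metricOf g) h φ)
    (humb : IsTotallyUmbilical (metricOf g) h φ) (hbih : IsFBiharmonic (metricOf g) h φ) :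
    IsTotallyGeodesic (metricOf g) h φ := by
  intro e he e' he' p hp hp' u v
  obtain ⟨f, -, hfpos, hf⟩ := hbih
  exact (isConfImmersion_chart hφ he he' (hconf e' he')).secondFF_eq_zero hm
    (mem_chartDomain hp hp') hK (secondFF_umbilical_chart humb he he')
    (fun y _ => (hfpos _).ne') (fBitension_chart hf he he') u v

/-! ### The charts of the space forms -/

lemma metricInChart_euclidean {n : ℕ} {e' : OpenPartialHomeomorph (Euc n) (Euc n)}
    (he' : e' ∈ atlas (Euc n) (Euc n)) (y : Euc n) :
    confFactor 1 0 y ≠ 0 ∧ metricInChart (euclideanMetric n) e' y = confMetric 1 0 y := by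
  rw [chartedSpaceSelf_atlas] at he'
  subst he'
  refine ⟨by simp [confFactor], ?_⟩
  funext u v
  have : mfderiv (𝓡 n) (𝓡 n) (OpenPartialHomeomorph.refl (Euc n)).symm y
      = ContinuousLinearMap.id ℝ (Euc n) := mfderiv_id
  simp only [metricInChart, euclideanMetric, confMetric, confFactor, this]
  simp only [zero_mul, add_zero, one_pow, inv_one, one_mul]
  rfl

lemma metricInChart_hyperbolic {n : ℕ} {e' : OpenPartialHomeomorph (HypSpace n) (Euc n)}
    (he' : e' ∈ atlas (Euc n) (HypSpace n)) {y : Euc n} (hy : y ∈ e'.target) :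
    confFactor (1 / 2) (-1 / 2) y ≠ 0 ∧
      metricInChart (hyperbolicMetric n) e' y = confMetric (1 / 2) (-1 / 2) y := by
  have hsymm : ∀ z ∈ e'.target, ((e'.symm z : HypSpace n) : Euc n) = z := by
    intro z hz
    -- The charts of an open subset are restrictions of ambient charts, here of the identity, so the
    -- inverse chart followed by the inclusion fixes each point of the target.
    obtain ⟨q, hq, rfl⟩ : ∃ (q : Euc n) (hq : q ∈ unitBall n),
        (chartAt (Euc n) q).subtypeRestr ⟨⟨q, hq⟩⟩ = e' := by
      simpa [atlas, ChartedSpace.atlas] using he'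
    exact OpenPartialHomeomorph.right_inv _ hz
  have hF : confFactor (1 / 2) (-1 / 2) y = (1 - ‖y‖ ^ 2) / 2 := by
    rw [confFactor, real_inner_self_eq_norm_sq]; ring
  have hball : ‖y‖ < 1 := by
    have := (e'.symm y).2
    rw [hsymm y hy] at this
    simpa [unitBall] using this
  have hpos : 0 < 1 - ‖y‖ ^ 2 := by nlinarith [norm_nonneg y]
  refine ⟨by rw [hF]; positivity, ?_⟩
  have d1 : MDifferentiableAt (𝓡 n) (𝓡 n) e'.symm y :=
    (contMDiffOn_symm_of_mem_maximalAtlas (IsManifold.subset_maximalAtlas (I := 𝓡 n) (n := ∞)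
      he')).contMDiffAt (e'.open_target.mem_nhds hy) |>.mdifferentiableAt (by simp)
  have d2 : MDifferentiableAt (𝓡 n) (𝓡 n) (Subtype.val : HypSpace n → Euc n) (e'.symm y) :=
    (contMDiff_subtype_val (n := ∞) (e'.symm y)).mdifferentiableAt (by simp)
  have hd : ∀ u : Euc n, mfderiv (𝓡 n) (𝓡 n) (Subtype.val : HypSpace n → Euc n) (e'.symm y)
      (mfderiv (𝓡 n) (𝓡 n) e'.symm y u) = u := by
    intro u
    have c := mfderiv_comp y d2 d1
    have ev : (Subtype.val : HypSpace n → Euc n) ∘ e'.symm =ᶠ[𝓝 y] id := by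
      filter_upwards [e'.open_target.mem_nhds hy] with z hz using hsymm z hz
    rw [ev.mfderiv_eq, mfderiv_id] at c
    exact (congrArg (fun T : Euc n →L[ℝ] Euc n => T u) c).symm
  funext u v
  simp only [metricInChart, hyperbolicMetric, euclideanMetric, hd, hsymm y hy, confMetric, hF]
  field_simp
  ring

/-! ### Stereographic coordinates on the sphere -/

section Stereographic

variable {n : ℕ}

/-- The inverse of the stereographic projection from the unit vector `v`, where the hyperplane
orthogonal to `v` is identified with `ℝⁿ` by means of the isometry `J`. -/
def stereoInv (J : Euc n →ₗᵢ[ℝ] Euc (n + 1)) (v : Euc (n + 1)) (y : Euc n) : Euc (n + 1) :=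
  (confFactor 1 (1 / 4) y)⁻¹ • (J y - (2 : ℝ) • v) + v

/-- The derivative of `stereoInv`. -/
def stereoInvDeriv (J : Euc n →ₗᵢ[ℝ] Euc (n + 1)) (v : Euc (n + 1)) (y u : Euc n) : Euc (n + 1) :=
  (confFactor 1 (1 / 4) y)⁻¹ • J u
    - (1 / 2 * ⟪y, u⟫ * (confFactor 1 (1 / 4) y ^ 2)⁻¹) • (J y - (2 : ℝ) • v)

lemma confFactor_stereo_pos (y : Euc n) : 0 < confFactor 1 (1 / 4) y := by
  have := real_inner_self_nonneg (x := y)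
  unfold confFactor
  positivity

variable {J : Euc n →ₗᵢ[ℝ] Euc (n + 1)} {v : Euc (n + 1)}

lemma hasDerivAt_stereoInv {p : ℝ → Euc n} {p' : Euc n} {t : ℝ} (hp : HasDerivAt p p' t) :
    HasDerivAt (fun s => stereoInv J v (p s)) (stereoInvDeriv J v (p t) p') t := by
  have hF := (confFactor_stereo_pos (p t)).ne'
  have hJ : HasDerivAt (fun s => J (p s)) (J p') t :=
    J.toContinuousLinearMap.hasFDerivAt.comp_hasDerivAt t hp
  have h := (((hasDerivAt_confFactor hp).inv hF).smul (hJ.sub_const ((2 : ℝ) • v))).add_const v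
  refine h.congr_deriv ?_
  simp only [stereoInvDeriv, Pi.inv_apply]
  match_scalars <;> field_simp <;> ring

/-- The Gauss formula for the sphere in stereographic coordinates. -/
lemma hasDerivAt_stereoInvDeriv {p a : ℝ → Euc n} {p' a' : Euc n} {t : ℝ}
    (hp : HasDerivAt p p' t) (ha : HasDerivAt a a' t) :
    HasDerivAt (fun s => stereoInvDeriv J v (p s) (a s))
      (stereoInvDeriv J v (p t) (a' + confChristoffel 1 (1 / 4) (p t) p' (a t))
        - confMetric 1 (1 / 4) (p t) p' (a t) • stereoInv J v (p t)) t := by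
  have hF := (confFactor_stereo_pos (p t)).ne'
  have hJ : ∀ {b : ℝ → Euc n} {b' : Euc n}, HasDerivAt b b' t →
      HasDerivAt (fun s => J (b s)) (J b') t := fun hb =>
    J.toContinuousLinearMap.hasFDerivAt.comp_hasDerivAt t hb
  have hf := hasDerivAt_confFactor (α := 1) (β := 1 / 4) hp
  have h := ((hf.inv hF).smul (hJ ha)).sub
    ((((hp.inner ℝ ha).const_mul (1 / 2)).mul ((hf.pow 2).inv (pow_ne_zero 2 hF))).smul
      ((hJ hp).sub_const ((2 : ℝ) • v)))
  refine h.congr_deriv ?_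
  have hF' : ⟪p t, p t⟫ = 4 * (confFactor 1 (1 / 4) (p t) - 1) := by simp [confFactor]
  simp only [stereoInvDeriv, stereoInv, confChristoffel, confMetric, Pi.inv_apply, Pi.mul_apply,
    Pi.pow_apply, map_add, map_sub, map_smul, inner_add_right, inner_sub_right, inner_smul_right]
  rw [hF', real_inner_comm p' (p t)]
  generalize confFactor 1 (1 / 4) (p t) = F at *
  match_scalars <;> field_simp <;> ring

lemma inner_stereoInvDeriv (hv : ‖v‖ = 1) (hJ : ∀ x, ⟪J x, v⟫ = 0) (y u w : Euc n) :
    ⟪stereoInvDeriv J v y u, stereoInvDeriv J v y w⟫ = confMetric 1 (1 / 4) y u w := by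
  have hF := (confFactor_stereo_pos y).ne'
  have hF' : ⟪y, y⟫ = 4 * (confFactor 1 (1 / 4) y - 1) := by simp [confFactor]
  have hv' : ⟪v, v⟫ = 1 := by rw [real_inner_self_eq_norm_sq, hv]; norm_num
  have hJ' : ∀ x, ⟪v, J x⟫ = 0 := fun x => by rw [real_inner_comm, hJ]
  simp only [stereoInvDeriv, confMetric, inner_sub_left, inner_sub_right, inner_smul_left,
    inner_smul_right, RCLike.conj_to_real, LinearIsometry.inner_map_map, hv', hJ, hJ', hF',
    real_inner_comm y u]
  field_simp
  ring

lemma inner_stereoInv_stereoInvDeriv (hv : ‖v‖ = 1) (hJ : ∀ x, ⟪J x, v⟫ = 0) (y u : Euc n) :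
    ⟪stereoInv J v y, stereoInvDeriv J v y u⟫ = 0 := by
  have hF := (confFactor_stereo_pos y).ne'
  have hF' : ⟪y, y⟫ = 4 * (confFactor 1 (1 / 4) y - 1) := by simp [confFactor]
  have hv' : ⟪v, v⟫ = 1 := by rw [real_inner_self_eq_norm_sq, hv]; norm_num
  have hJ' : ∀ x, ⟪v, J x⟫ = 0 := fun x => by rw [real_inner_comm, hJ]
  simp only [stereoInv, stereoInvDeriv, inner_sub_left, inner_sub_right, inner_smul_left,
    inner_add_left,
    inner_smul_right, RCLike.conj_to_real, LinearIsometry.inner_map_map, hv', hJ, hJ', hF']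
  field_simp
  ring

lemma differentiable_stereoInv : Differentiable ℝ (stereoInv J v) := fun y =>
  ((((differentiableAt_id.inner ℝ differentiableAt_id).const_mul (1 / 4)).const_add 1).inv
    (confFactor_stereo_pos y).ne').smul
      (J.toContinuousLinearMap.differentiableAt.sub_const _) |>.add_const v

lemma fderiv_stereoInv (y u : Euc n) : fderiv ℝ (stereoInv J v) y u = stereoInvDeriv J v y u := by
  refine fderiv_eq_of_hasDerivAt_line (differentiable_stereoInv y) ?_
  have := hasDerivAt_stereoInv (J := J) (v := v) (hasDerivAt_line y u)
  simpa using this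

/-- Every chart of the sphere is a stereographic projection, with |y|² + 4 = 4F as the denominator
of its inverse; this normalization explains β = 1/4. -/
lemma exists_stereoInv {e' : OpenPartialHomeomorph (UnitSphere n) (Euc n)}
    (he' : e' ∈ atlas (Euc n) (UnitSphere n)) :
    ∃ (J : Euc n →ₗᵢ[ℝ] Euc (n + 1)) (v : Euc (n + 1)), ‖v‖ = 1 ∧ (∀ x, ⟪J x, v⟫ = 0) ∧
      e'.target = Set.univ ∧ ∀ y, (e'.symm y : Euc (n + 1)) = stereoInv J v y := by
  have := Fact.mk (@finrank_euclideanSpace_fin ℝ _ (n + 1))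
  obtain ⟨v, rfl⟩ : ∃ v : UnitSphere n, e' = stereographic' n v := he'
  let V : (Submodule.span ℝ {(v : Euc (n + 1))})ᗮ ≃ₗᵢ[ℝ] Euc n :=
    (OrthonormalBasis.fromOrthogonalSpanSingleton n (ne_zero_of_mem_unit_sphere v)).repr
  refine ⟨(Submodule.subtypeₗᵢ _).comp V.symm.toLinearIsometry, v, norm_eq_of_mem_sphere v,
    fun x => ?_, stereographic'_target v, fun y => ?_⟩
  · exact Submodule.mem_orthogonal_singleton_iff_inner_left.1 (V.symm x).2
  · rw [stereographic'_symm_apply]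
    have hn : ‖((V.symm y : (Submodule.span ℝ {(v : Euc (n + 1))})ᗮ) : Euc (n + 1))‖ = ‖y‖ :=
      V.symm.norm_map y
    have hF : ‖y‖ ^ 2 + 4 = 4 * confFactor 1 (1 / 4) y := by
      rw [confFactor, real_inner_self_eq_norm_sq]; ring
    have hF2 : ‖y‖ ^ 2 - 4 = 4 * confFactor 1 (1 / 4) y - 8 := by
      rw [confFactor, real_inner_self_eq_norm_sq]; ring
    have hF0 := (confFactor_stereo_pos y).ne'
    change (‖((V.symm y : _) : Euc (n + 1))‖ ^ 2 + 4)⁻¹ • (4 : ℝ) • ((V.symm y : _) : Euc (n + 1)) +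
      (‖((V.symm y : _) : Euc (n + 1))‖ ^ 2 + 4)⁻¹ • (‖((V.symm y : _) : Euc (n + 1))‖ ^ 2 - 4) •
        (v : Euc (n + 1)) = (confFactor 1 (1 / 4) y)⁻¹ • (((V.symm y : _) : Euc (n + 1))
          - (2 : ℝ) • (v : Euc (n + 1))) + v
    rw [hn, hF, hF2]
    match_scalars <;> field_simp
    ring

lemma metricInChart_sphere {e' : OpenPartialHomeomorph (UnitSphere n) (Euc n)}
    (he' : e' ∈ atlas (Euc n) (UnitSphere n)) (y : Euc n) :
    confFactor 1 (1 / 4) y ≠ 0 ∧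
      metricInChart (sphereMetric n) e' y = confMetric 1 (1 / 4) y := by
  refine ⟨(confFactor_stereo_pos y).ne', ?_⟩
  have := Fact.mk (@finrank_euclideanSpace_fin ℝ _ (n + 1))
  obtain ⟨J, v, hv, hJ, htarget, hsymm⟩ := exists_stereoInv he'
  have d1 : MDifferentiableAt (𝓡 n) (𝓡 n) e'.symm y :=
    (contMDiffOn_symm_of_mem_maximalAtlas (IsManifold.subset_maximalAtlas (I := 𝓡 n) (n := ω)
      he')).contMDiffAt (e'.open_target.mem_nhds (by simp [htarget])) |>.mdifferentiableAt (by simp)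
  have d2 : MDifferentiableAt (𝓡 n) (𝓡 (n + 1)) (Subtype.val : UnitSphere n → Euc (n + 1))
      (e'.symm y) :=
    (contMDiff_coe_sphere (m := ω) (e'.symm y)).mdifferentiableAt (by simp)
  have hd : ∀ u : Euc n, mfderiv (𝓡 n) (𝓡 (n + 1)) (Subtype.val : UnitSphere n → Euc (n + 1))
      (e'.symm y) (mfderiv (𝓡 n) (𝓡 n) e'.symm y u) = stereoInvDeriv J v y u := by
    intro u
    have c := mfderiv_comp y d2 d1
    have ev : (Subtype.val : UnitSphere n → Euc (n + 1)) ∘ e'.symm = stereoInv J v :=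
      funext hsymm
    rw [ev, mfderiv_eq_fderiv] at c
    rw [← fderiv_stereoInv]
    exact (congrArg (fun T : Euc n →L[ℝ] Euc (n + 1) => T u) c).symm
  funext u w
  simp only [metricInChart, sphereMetric, euclideanMetric, hd]
  exact inner_stereoInvDeriv hv hJ y u w

end Stereographic

/-! ### Hypersurfaces of the sphere -/

/-- Near `p`, the image of the map `φ` into the unit sphere lies in the small sphere
`{x | ⟪x, C⟫ = c}`, where `C` is normalized by `|C|² = 1 + c²`. -/
def IsLocallyInSmallSphere {n : ℕ} {M : Type*} [TopologicalSpace M] (φ : M → UnitSphere n)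
    (C : Euc (n + 1)) (c : ℝ) (p : M) : Prop :=
  ⟪C, C⟫ = 1 + c ^ 2 ∧ ∀ᶠ q in 𝓝 p, ⟪(φ q : Euc (n + 1)), C⟫ = c

/-- The vector D = ν + cx is constant: by the Gauss formula the derivative of ν is the image of ∇N =
-c dψ, its position component vanishing because N is normal, and this cancels c dx. As ν is a unit
vector orthogonal to x, ⟨D, D⟩ = 1 + c² and ⟨x, D⟩ = c. -/
lemma IsConfImmersion.eventually_inner_stereoInv {n : ℕ} {U : Set (Euc n)}
    {ψ : Euc n → Euc (n + 1)} {G : Euc n → Euc n → Euc n → ℝ}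
    {H : Euc (n + 1) → Euc (n + 1) → Euc (n + 1) → ℝ} {x : Euc n}
    (h : IsConfImmersion 1 (1 / 4) U ψ G H) (hx : x ∈ U)
    {N : Euc n → Euc (n + 1)} {c : ℝ}
    (hN : ∀ᶠ y in 𝓝 x, DifferentiableAt ℝ N y ∧
      confMetric 1 (1 / 4) (ψ y) (N y) (N y) = 1 ∧
      (∀ v, confMetric 1 (1 / 4) (ψ y) (N y) (fderiv ℝ ψ y v) = 0) ∧
      (∀ u, covAlong H ψ N y u = -c • fderiv ℝ ψ y u) ∧
      tension G H ψ y = (n * c) • N y)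
    {J : Euc (n + 1) →ₗᵢ[ℝ] Euc (n + 1 + 1)} {v : Euc (n + 1 + 1)} (hv : ‖v‖ = 1)
    (hJ : ∀ x, ⟪J x, v⟫ = 0) (hunit : ∀ y, ⟪stereoInv J v y, stereoInv J v y⟫ = 1) :
    ∃ C, ⟪C, C⟫ = 1 + c ^ 2 ∧ ∀ᶠ y in 𝓝 x, ⟪stereoInv J v (ψ y), C⟫ = c := by
  set D : Euc n → Euc (n + 1 + 1) :=
    fun y => stereoInvDeriv J v (ψ y) (N y) + c • stereoInv J v (ψ y) with hD
  have hDd : ∀ᶠ y in 𝓝 x, DifferentiableAt ℝ D y ∧ fderiv ℝ D y = 0 := by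
    filter_upwards [hN, h.mem_nhds hx] with y ⟨h0, _, h2, h3, _⟩ hy
    have hp := h.differentiableAt hy
    have hF : DifferentiableAt ℝ (fun z => confFactor 1 (1 / 4) (ψ z)) y :=
      ((hp.inner ℝ hp).const_mul _).const_add _
    have hF0 := (confFactor_stereo_pos (ψ y)).ne'
    have hJd : ∀ {b : Euc n → Euc (n + 1)}, DifferentiableAt ℝ b y →
        DifferentiableAt ℝ (fun z => J (b z)) y := fun hb =>
      J.toContinuousLinearMap.differentiableAt.comp y hb
    have d1 : DifferentiableAt ℝ D y :=
      (((hF.inv hF0).smul (hJd h0)).sub ((((hp.inner ℝ h0).const_mul _).mul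
        ((hF.pow 2).inv (pow_ne_zero 2 hF0))).smul ((hJd hp).sub_const _))).add
        ((differentiable_stereoInv.differentiableAt.comp y hp).const_smul c)
    refine ⟨d1, ?_⟩
    ext1 u
    refine (fderiv_eq_of_hasDerivAt_line d1 (d := 0) ?_)
    have l1 := hasDerivAt_comp_line hp u
    have l2 := hasDerivAt_comp_line h0 u
    refine ((hasDerivAt_stereoInvDeriv (J := J) (v := v) l1 l2).add
      ((hasDerivAt_stereoInv (J := J) (v := v) l1).const_smul c)).congr_deriv ?_
    have e1 := h.covAlong_eq hy N u
    rw [h3] at e1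
    simp only [zero_smul, add_zero]
    rw [← e1, confMetric_comm, h2, zero_smul, sub_zero]
    simp only [stereoInvDeriv, map_smul, inner_smul_right]
    module
  have hDc := eventually_eq_of_fderiv_eq_zero hDd
  have key : ∀ᶠ y in 𝓝 x, ⟪D y, D y⟫ = 1 + c ^ 2 ∧ ⟪stereoInv J v (ψ y), D y⟫ = c := by
    filter_upwards [hN] with y ⟨_, h1, _⟩
    have e2 := inner_stereoInv_stereoInvDeriv hv hJ (ψ y) (N y)
    have e3 := inner_stereoInvDeriv hv hJ (ψ y) (N y) (N y)
    have e4 := e2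
    rw [real_inner_comm] at e4
    simp only [hD, inner_add_left, inner_add_right, inner_smul_left, inner_smul_right, hunit, e2,
      e3, e4, h1, RCLike.conj_to_real]
    constructor <;> ring
  refine ⟨D x, key.self_of_nhds.1, ?_⟩
  filter_upwards [hDc, key] with y h1 h2
  rw [← h1]
  exact h2.2

lemma IsLocallyInSmallSphere.neg {n : ℕ} {M : Type*} [TopologicalSpace M]
    {φ : M → UnitSphere n} {C : Euc (n + 1)} {c : ℝ} {p : M}
    (h : IsLocallyInSmallSphere φ C c p) : IsLocallyInSmallSphere φ (-C) (-c) p := by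
  refine ⟨by rw [inner_neg_neg, h.1, neg_sq], ?_⟩
  filter_upwards [h.2] with q hq
  rw [inner_neg_right, hq]

lemma eventually_chart_symm {m : ℕ} {M : Type*} [TopologicalSpace M] [ChartedSpace (Euc m) M]
    {P : M → Prop} {p : M} (h : ∀ᶠ q in 𝓝 p, P q) :
    ∀ᶠ x in 𝓝 (chartAt (Euc m) p p), P ((chartAt (Euc m) p).symm x) := by
  have hp := mem_chart_source (Euc m) p
  have h1 := (chartAt (Euc m) p).continuousAt_symm ((chartAt (Euc m) p).map_source hp)
  rw [ContinuousAt, (chartAt (Euc m) p).left_inv hp] at h1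
  exact h1.eventually h

section Sphere

variable {m : ℕ} {M : Type*} [TopologicalSpace M] [ChartedSpace (Euc m) M] [IsManifold (𝓡 m) ∞ M]
  {g : Bundle.ContMDiffRiemannianMetric (𝓡 m) ∞ (Euc m) (fun p : M => TangentSpace (𝓡 m) p)}
  {φ : M → UnitSphere (m + 1)}

lemma inner_self_sphere {n : ℕ} (x : UnitSphere n) : ⟪(x : Euc (n + 1)), (x : Euc (n + 1))⟫ = 1 := by
  rw [real_inner_self_eq_norm_sq, norm_eq_of_mem_sphere]; norm_num

lemma exists_isLocallyInSmallSphere (hm : 2 ≤ m)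
    (hφ : IsIsometricImmersion (metricOf g) (sphereMetric (m + 1)) φ)
    (humb : IsTotallyUmbilical (metricOf g) (sphereMetric (m + 1)) φ)
    (hbih : IsFBiharmonic (metricOf g) (sphereMetric (m + 1)) φ) (p : M) :
    ∃ C c, (c = 0 ∨ c ^ 2 = 1) ∧ IsLocallyInSmallSphere φ C c p := by
  obtain ⟨f, -, hfpos, hf⟩ := hbih
  have he := chart_mem_atlas (Euc m) p
  have he' := chart_mem_atlas (Euc (m + 1)) (φ p)
  set e := chartAt (Euc m) p with hedef
  set e' := chartAt (Euc (m + 1)) (φ p) with hedef'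
  have hp : p ∈ e.source := mem_chart_source _ p
  have hp' : φ p ∈ e'.source := mem_chart_source _ (φ p)
  have h := isConfImmersion_chart hφ he he' (fun y _ => metricInChart_sphere he' y)
  have hx := mem_chartDomain hp hp'
  obtain ⟨N, c, hN⟩ := h.exists_normal_of_umbilical hm (secondFF_umbilical_chart humb he he') hx
  have hc := h.mean_curvature_of_fBiharmonic (by omega) hx (fun y _ => (hfpos _).ne')
    (fBitension_chart hf he he') hN
  obtain ⟨J, v, hv, hJ, -, hsymm⟩ := exists_stereoInv he'
  obtain ⟨C, hC, hC'⟩ := h.eventually_inner_stereoInv hx hN hv hJ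
    (fun y => by rw [← hsymm]; exact inner_self_sphere _)
  refine ⟨C, c, ?_, hC, ?_⟩
  · rcases hc with hc | hc
    · exact Or.inl hc
    · right; rw [hc]; norm_num
  · have h1 := (e.continuousAt hp).eventually hC'
    filter_upwards [h1, e.open_source.mem_nhds hp,
      hφ.1.continuous.continuousAt.eventually_mem (e'.open_source.mem_nhds hp')] with q hq hqe hqe'
    rw [← hsymm] at hq
    simpa only [Function.comp_apply, e.left_inv hqe, e'.left_inv hqe'] using hq

/-- The inclusion of the hypersurface into the ambient Euclidean space, in a chart, is an
immersion. -/
lemma contDiffAt_sphere_chart (hφ : IsIsometricImmersion (metricOf g) (sphereMetric (m + 1)) φ)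
    (p : M) :
    ContDiffAt ℝ 1 (fun x => (φ ((chartAt (Euc m) p).symm x) : Euc (m + 1 + 1)))
        (chartAt (Euc m) p p) ∧
      Function.Injective (fderiv ℝ
        (fun x => (φ ((chartAt (Euc m) p).symm x) : Euc (m + 1 + 1))) (chartAt (Euc m) p p)) := by
  have he := chart_mem_atlas (Euc m) p
  have he' := chart_mem_atlas (Euc (m + 1)) (φ p)
  set e := chartAt (Euc m) p with hedef
  set e' := chartAt (Euc (m + 1)) (φ p) with hedef'
  have hp : p ∈ e.source := mem_chart_source _ p
  have hp' : φ p ∈ e'.source := mem_chart_source _ (φ p)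
  have h := isConfImmersion_chart hφ he he' (fun y _ => metricInChart_sphere he' y)
  have hx := mem_chartDomain hp hp'
  obtain ⟨J, v, hv, hJ, -, hsymm⟩ := exists_stereoInv he'
  have hev : (fun x => (φ (e.symm x) : Euc (m + 1 + 1)))
      =ᶠ[𝓝 (e p)] stereoInv J v ∘ (e' ∘ φ ∘ e.symm) := by
    filter_upwards [h.mem_nhds hx] with y hy
    simp only [Function.comp_apply, ← hsymm, e'.left_inv hy.2]
  have hd := h.differentiableAt hx
  constructor
  · have hσ : ContDiff ℝ 1 (stereoInv J v) := by
      have hF : ContDiff ℝ 1 fun y : Euc (m + 1) => confFactor 1 (1 / 4) y :=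
        contDiff_const.add (contDiff_const.mul (contDiff_id.inner ℝ contDiff_id))
      exact ((hF.inv fun y => (confFactor_stereo_pos y).ne').smul
        (J.toContinuousLinearMap.contDiff.sub contDiff_const)).add contDiff_const
    exact (hσ.contDiffAt.comp _ ((h.contDiffAt_two hx).of_le (by norm_num))).congr_of_eventuallyEq
      hev
  · rw [hev.fderiv_eq, fderiv_comp _ differentiable_stereoInv.differentiableAt hd,
      injective_iff_map_eq_zero]
    intro u hu
    rw [ContinuousLinearMap.comp_apply, fderiv_stereoInv] at hu
    have e1 := inner_stereoInvDeriv hv hJ ((e' ∘ φ ∘ e.symm) (e p))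
      (fderiv ℝ (e' ∘ φ ∘ e.symm) (e p) u) (fderiv ℝ (e' ∘ φ ∘ e.symm) (e p) u)
    rw [hu, inner_zero_left, ← h.pullback _ hx] at e1
    by_contra hne
    exact (h.pos _ hx u hne).ne e1

lemma IsLocallyInSmallSphere.inner_fderiv {C : Euc (m + 1 + 1)} {c : ℝ} {p : M}
    (hφ : IsIsometricImmersion (metricOf g) (sphereMetric (m + 1)) φ)
    (h : IsLocallyInSmallSphere φ C c p) (u : Euc m) :
    ⟪fderiv ℝ (fun x => (φ ((chartAt (Euc m) p).symm x) : Euc (m + 1 + 1)))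
      (chartAt (Euc m) p p) u, C⟫ = 0 := by
  have hd := (contDiffAt_sphere_chart hφ p).1.differentiableAt (by norm_num)
  have h1 := fderiv_inner_apply ℝ hd (differentiableAt_const C) u
  have h2 : (fun x => ⟪(φ ((chartAt (Euc m) p).symm x) : Euc (m + 1 + 1)), C⟫)
      =ᶠ[𝓝 (chartAt (Euc m) p p)] fun _ => c := eventually_chart_symm h.2
  rw [h2.fderiv_eq] at h1
  simpa using h1.symm

lemma inner_fderiv_self (hφ : IsIsometricImmersion (metricOf g) (sphereMetric (m + 1)) φ)
    (p : M) (u : Euc m) :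
    ⟪fderiv ℝ (fun x => (φ ((chartAt (Euc m) p).symm x) : Euc (m + 1 + 1)))
      (chartAt (Euc m) p p) u, (φ p : Euc (m + 1 + 1))⟫ = 0 := by
  have hd := (contDiffAt_sphere_chart hφ p).1.differentiableAt (by norm_num)
  have h1 := fderiv_inner_apply ℝ hd hd u
  simp only [inner_self_sphere] at h1
  rw [(chartAt (Euc m) p).left_inv (mem_chart_source (Euc m) p), real_inner_comm] at h1
  simp at h1
  linarith

/-- At a point, the normalized equations of two small spheres containing a hypersurface differ by
a multiple of the position vector, up to sign. -/
lemma IsLocallyInSmallSphere.sub_or_add {C C' : Euc (m + 1 + 1)} {c c' : ℝ} {p : M}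
    (hφ : IsIsometricImmersion (metricOf g) (sphereMetric (m + 1)) φ)
    (h : IsLocallyInSmallSphere φ C c p) (h' : IsLocallyInSmallSphere φ C' c' p) :
    C' - C = (c' - c) • (φ p : Euc (m + 1 + 1)) ∨ C' + C = (c' + c) • (φ p : Euc (m + 1 + 1)) := by
  set x : Euc (m + 1 + 1) := (φ p : Euc (m + 1 + 1)) with hx
  set L := fderiv ℝ (fun x => (φ ((chartAt (Euc m) p).symm x) : Euc (m + 1 + 1)))
      (chartAt (Euc m) p p) with hL
  have hLinj : Function.Injective L := (contDiffAt_sphere_chart hφ p).2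
  have hLx : ∀ u, ⟪L u, x⟫ = 0 := inner_fderiv_self hφ p
  have hxx : ⟪x, x⟫ = 1 := inner_self_sphere _
  -- The tangent space and the position vector together span a subspace of dimension m + 1, whose
  -- complement is a line. Both C - cx and C' - c'x are unit vectors on that line, hence equal up to
  -- sign.
  let T : Euc m × ℝ →ₗ[ℝ] Euc (m + 1 + 1) :=
    L.toLinearMap.coprod (LinearMap.toSpanSingleton ℝ _ x)
  have hT : ∀ u s, T (u, s) = L u + s • x := fun u s => by simp [T]
  have hTinj : Function.Injective T := by
    rw [injective_iff_map_eq_zero]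
    rintro ⟨u, s⟩ hus
    rw [hT] at hus
    have h1 : s = 0 := by
      have := congrArg (fun a => ⟪a, x⟫) hus
      simp only [inner_add_left, inner_smul_left, hLx, hxx, inner_zero_left] at this
      simpa using this
    subst h1
    rw [zero_smul, add_zero] at hus
    rw [(injective_iff_map_eq_zero _).1 hLinj u hus]
    rfl
  have hperp : ∀ {D : Euc (m + 1 + 1)} {d : ℝ}, IsLocallyInSmallSphere φ D d p →
      D - d • x ∈ (LinearMap.range T)ᗮ ∧ ⟪D - d • x, D - d • x⟫ = 1 := by
    intro D d hD
    have h1 : ⟪x, D⟫ = d := hD.2.self_of_nhds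
    have h1' : ⟪D, x⟫ = d := by rw [real_inner_comm, h1]
    have hDL : ∀ u, ⟪L u, D⟫ = 0 := hD.inner_fderiv hφ
    constructor
    · rintro _ ⟨⟨u, s⟩, rfl⟩
      rw [hT]
      simp only [inner_add_left, inner_smul_left, inner_sub_right, inner_smul_right, hLx, hxx,
        hDL, h1, RCLike.conj_to_real]
      ring
    · simp only [inner_smul_left, inner_sub_right, inner_sub_left, inner_smul_right, hxx, hD.1, h1,
        h1', RCLike.conj_to_real]
      ring
  obtain ⟨s, hs⟩ := exists_smul_of_mem_orthogonal (W := LinearMap.range T)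
    (by rw [LinearMap.finrank_range_of_inj hTinj]; simp)
    (fun h0 => by simpa [h0] using (hperp h).2) (hperp h).1 (hperp h').1
  have hs2 : s ^ 2 = 1 := by
    have := (hperp h').2
    rw [hs, inner_smul_left, inner_smul_right, (hperp h).2, RCLike.conj_to_real] at this
    linarith
  rcases mul_self_eq_one_iff.1 ((sq s).symm.trans hs2) with rfl | rfl
  · left
    linear_combination (norm := module) hs
  · right
    linear_combination (norm := module) hs

/-- If the pairs did not agree up to sign, the pointwise alternative would express φ(q), for every q
near p, as one of two fixed vectors. By continuity φ would be locally constant, contradicting that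
it is an immersion of positive dimension. -/
lemma IsLocallyInSmallSphere.unique (hm : m ≠ 0) {C C' : Euc (m + 1 + 1)} {c c' : ℝ} {p : M}
    (hφ : IsIsometricImmersion (metricOf g) (sphereMetric (m + 1)) φ)
    (h : IsLocallyInSmallSphere φ C c p) (h' : IsLocallyInSmallSphere φ C' c' p) :
    (C' = C ∧ c' = c) ∨ (C' = -C ∧ c' = -c) := by
  by_contra hcon
  push Not at hcon
  set a : Euc (m + 1 + 1) := (c' - c)⁻¹ • (C' - C)
  set b : Euc (m + 1 + 1) := (c' + c)⁻¹ • (C' + C)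
  have hab : ∀ᶠ q in 𝓝 p, (φ q : Euc (m + 1 + 1)) ∈ ({a, b} : Set (Euc (m + 1 + 1))) := by
    filter_upwards [h.2.eventually_nhds, h'.2.eventually_nhds] with q hq hq'
    rcases IsLocallyInSmallSphere.sub_or_add hφ ⟨h.1, hq⟩ ⟨h'.1, hq'⟩ with h1 | h1
    · left
      have h0 : c' - c ≠ 0 := fun h0 => by
        rw [h0, zero_smul, sub_eq_zero] at h1
        exact hcon.1 h1 (sub_eq_zero.1 h0)
      simp only [a, h1, smul_smul, inv_mul_cancel₀ h0, one_smul]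
    · right
      have h0 : c' + c ≠ 0 := fun h0 => by
        rw [h0, zero_smul] at h1
        exact hcon.2 (eq_neg_of_add_eq_zero_left h1) (eq_neg_of_add_eq_zero_left h0)
      simp only [b, h1, smul_smul, inv_mul_cancel₀ h0, one_smul, Set.mem_singleton_iff]
  have hcont : ContinuousAt (fun q => (φ q : Euc (m + 1 + 1))) p :=
    (continuous_subtype_val.comp hφ.1.continuous).continuousAt
  have hconst : ∀ᶠ q in 𝓝 p, (φ q : Euc (m + 1 + 1)) = φ p := by
    have hfin : (({a, b} : Set (Euc (m + 1 + 1))) \ {(φ p : Euc (m + 1 + 1))}).Finite :=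
      (Set.toFinite _).subset Set.sdiff_subset
    filter_upwards [hab, hcont.eventually_mem (hfin.isClosed.isOpen_compl.mem_nhds
      (fun h0 => h0.2 rfl))] with q h1 h2
    by_contra hne
    exact h2 ⟨h1, hne⟩
  have hder : fderiv ℝ (fun x => (φ ((chartAt (Euc m) p).symm x) : Euc (m + 1 + 1)))
      (chartAt (Euc m) p p) = 0 := by
    have h2 : (fun x => (φ ((chartAt (Euc m) p).symm x) : Euc (m + 1 + 1)))
      =ᶠ[𝓝 (chartAt (Euc m) p p)] fun _ => (φ p : Euc (m + 1 + 1)) := eventually_chart_symm hconst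
    rw [h2.fderiv_eq]
    simp
  have hinj := (contDiffAt_sphere_chart hφ p).2
  rw [hder] at hinj
  have : (bvec ⟨0, Nat.pos_of_ne_zero hm⟩ : Euc m) = 0 := hinj rfl
  have h1 := inner_bvec_bvec (⟨0, Nat.pos_of_ne_zero hm⟩ : Fin m) ⟨0, Nat.pos_of_ne_zero hm⟩
  rw [this, inner_zero_left, Matrix.one_apply_eq] at h1
  exact zero_ne_one h1

/-- A connected, totally umbilical, `f`-biharmonic hypersurface of the sphere lies in a small
sphere. -/
lemma exists_smallSphere [ConnectedSpace M] (hm : 2 ≤ m)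
    (hφ : IsIsometricImmersion (metricOf g) (sphereMetric (m + 1)) φ)
    (humb : IsTotallyUmbilical (metricOf g) (sphereMetric (m + 1)) φ)
    (hbih : IsFBiharmonic (metricOf g) (sphereMetric (m + 1)) φ) :
    ∃ C c, (c = 0 ∨ c ^ 2 = 1) ∧ ⟪C, C⟫ = 1 + c ^ 2 ∧
      ∀ p, ⟪(φ p : Euc (m + 1 + 1)), C⟫ = c := by
  obtain ⟨p₀⟩ : Nonempty M := inferInstance
  obtain ⟨C, c, hc, h₀⟩ := exists_isLocallyInSmallSphere hm hφ humb hbih p₀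
  have hopen : IsOpen {p | IsLocallyInSmallSphere φ C c p} := by
    rw [isOpen_iff_eventually]
    intro p hp
    filter_upwards [hp.2.eventually_nhds] with q hq using ⟨hp.1, hq⟩
  have hclosed : IsClosed {p | IsLocallyInSmallSphere φ C c p} := by
    rw [← isOpen_compl_iff, isOpen_iff_eventually]
    intro p hp
    -- Every point p has its own pair (C', c'). If points of the set lie arbitrarily near p,
    -- uniqueness at such a point identifies this pair with ±(C, c), so p belongs to the set.
    obtain ⟨C', c', -, hp'⟩ := exists_isLocallyInSmallSphere hm hφ humb hbih p
    filter_upwards [hp'.2.eventually_nhds] with q hq hqC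
    refine hp ?_
    rcases IsLocallyInSmallSphere.unique (by omega) hφ ⟨hp'.1, hq⟩ hqC with ⟨h1, h2⟩ | ⟨h1, h2⟩
    · rw [h1, h2]; exact hp'
    · rw [h1, h2]; exact hp'.neg
  have huniv := IsClopen.eq_univ ⟨hclosed, hopen⟩ ⟨p₀, h₀⟩
  exact ⟨C, c, hc, h₀.1, fun p =>
    ((Set.eq_univ_iff_forall.1 huniv p : IsLocallyInSmallSphere φ C c p)).2.self_of_nhds⟩

/-- A hypersurface of the sphere contained in a small sphere is relatively open in it. -/
lemma eventually_mem_range {C : Euc (m + 1 + 1)} {c : ℝ}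
    (hφ : IsIsometricImmersion (metricOf g) (sphereMetric (m + 1)) φ)
    (hC : ⟪C, C⟫ = 1 + c ^ 2) (hφC : ∀ p, ⟪(φ p : Euc (m + 1 + 1)), C⟫ = c) (p : M) :
    ∀ᶠ x : UnitSphere (m + 1) in 𝓝 (φ p), ⟪(x : Euc (m + 1 + 1)), C⟫ = c → ∃ q, x = φ q := by
  obtain ⟨hF, hinj⟩ := contDiffAt_sphere_chart hφ p
  have hLx := inner_fderiv_self hφ p
  have hLC := IsLocallyInSmallSphere.inner_fderiv hφ (c := c) (p := p)
    ⟨hC, Eventually.of_forall hφC⟩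
  set F : Euc m → Euc (m + 1 + 1) :=
    fun x => (φ ((chartAt (Euc m) p).symm x) : Euc (m + 1 + 1)) with hFdef
  set x₀ := chartAt (Euc m) p p with hx₀
  have hFx₀ : F x₀ = φ p := by
    rw [hFdef]
    simp only [hx₀, (chartAt (Euc m) p).left_inv (mem_chart_source (Euc m) p)]
  have hF' := hF.hasStrictFDerivAt (by norm_num)
  set L := fderiv ℝ F x₀ with hL
  -- Two transverse parameters, radial and along C, complete the immersion to a map between spaces
  -- of equal dimension m + 2. Its derivative at (x₀, 0, 0) is bijective, since the Gram determinant
  -- of φ(p) and C is 1 + c² - c² = 1, so Θ is open there.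
  let Θ : Euc m × ℝ × ℝ → Euc (m + 1 + 1) := fun z => (1 + z.2.1) • F z.1 + z.2.2 • C
  obtain ⟨Θ', hΘ', hΘ''⟩ : ∃ Θ' : Euc m × ℝ × ℝ →L[ℝ] Euc (m + 1 + 1),
      HasStrictFDerivAt Θ Θ' (x₀, 0, 0) ∧
      ∀ u t s, Θ' (u, t, s) = L u + t • (φ p : Euc (m + 1 + 1)) + s • C := by
    have h1 : HasStrictFDerivAt (fun z : Euc m × ℝ × ℝ => z.1)
      (ContinuousLinearMap.fst ℝ (Euc m) (ℝ × ℝ)) (x₀, 0, 0) := hasStrictFDerivAt_fst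
    have h2 : HasStrictFDerivAt (fun z : Euc m × ℝ × ℝ => z.2)
      (ContinuousLinearMap.snd ℝ (Euc m) (ℝ × ℝ)) (x₀, 0, 0) := hasStrictFDerivAt_snd
    have h3 := (hF'.comp (x₀, (0 : ℝ), (0 : ℝ)) h1)
    have h4 := (h2.fst.const_add 1).smul h3
    have h5 := h2.snd.smul_const C
    refine ⟨_, h4.add h5, fun u t s => ?_⟩
    simp [hFx₀]
  have hinjΘ : Function.Injective Θ'.toLinearMap := by
    rw [injective_iff_map_eq_zero]
    rintro ⟨u, t, s⟩ hz
    have hz' : L u + t • (φ p : Euc (m + 1 + 1)) + s • C = 0 := by rw [← hΘ'']; exact hz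
    have i1 := congrArg (fun a => ⟪a, (φ p : Euc (m + 1 + 1))⟫) hz'
    have i2 := congrArg (fun a => ⟪a, C⟫) hz'
    simp only [inner_add_left, inner_smul_left, hLx, hLC, inner_self_sphere, hφC, hC,
      real_inner_comm _ C, inner_zero_left, RCLike.conj_to_real] at i1 i2
    have ht : t = -(s * c) := by linarith
    have hs : s = 0 := by rw [ht] at i2; linarith
    subst hs
    have ht : t = 0 := by rw [ht]; ring
    subst ht
    rw [zero_smul, zero_smul, add_zero, add_zero] at hz'
    rw [(injective_iff_map_eq_zero _).1 hinj u hz']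
    rfl
  have hsurj : Θ'.range = ⊤ :=
    LinearMap.range_eq_top.2 ((LinearMap.injective_iff_surjective_of_finrank_eq_finrank
      (by simp)).1 hinjΘ)
  have hmap := hΘ'.map_nhds_eq_of_surj hsurj
  have hΘ0 : Θ (x₀, 0, 0) = φ p := by simp [Θ, hFx₀]
  rw [hΘ0] at hmap
  -- The equations |x|² = 1 and ⟨x, C⟩ = c will leave t(t + 2) = 0; the bound t > -1 discards the
  -- root t = -2.
  have hQ : {z : Euc m × ℝ × ℝ | -1 < z.2.1} ∈ 𝓝 (x₀, (0 : ℝ), (0 : ℝ)) :=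
    (isOpen_lt continuous_const (continuous_fst.comp continuous_snd)).mem_nhds (by simp)
  have himage := Filter.image_mem_map (m := Θ) hQ
  rw [hmap] at himage
  filter_upwards [continuous_subtype_val.continuousAt.eventually_mem himage] with x hx hxC
  obtain ⟨⟨y, t, s⟩, ht, hyx⟩ := hx
  replace ht : -1 < t := ht
  refine ⟨(chartAt (Euc m) p).symm y, Subtype.ext ?_⟩
  have hFF : ⟪F y, F y⟫ = 1 := inner_self_sphere _
  have hFC : ⟪F y, C⟫ = c := hφC _
  have hCF : ⟪C, F y⟫ = c := by rw [real_inner_comm, hFC]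
  have hxx := inner_self_sphere x
  have hyx' : (1 + t) • F y + s • C = x := hyx
  rw [← hyx'] at hxx hxC
  simp only [inner_add_left, inner_add_right, inner_smul_left, inner_smul_right, hFF, hFC, hCF, hC,
    RCLike.conj_to_real] at hxx hxC
  have hs : s * (1 + c ^ 2) = -(t * c) := by linarith
  have ht2 : t * (t + 2) = 0 := by linear_combination (1 + c ^ 2) * hxx
    - (s * (1 + c ^ 2) - t * c + 2 * (1 + t) * c) * hs
  have ht0 : t = 0 := (mul_eq_zero.1 ht2).resolve_right (by linarith)
  have hs0 : s = 0 := by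
    rw [ht0, zero_mul, neg_zero] at hs
    exact (mul_eq_zero.1 hs).resolve_right (by positivity)
  rw [← hyx', ht0, hs0]
  simp [hFdef]

lemma isPartOfUpToIsometry {C : Euc (m + 1 + 1)} {c a κ : ℝ}
    (hφ : IsIsometricImmersion (metricOf g) (sphereMetric (m + 1)) φ)
    (hC : ⟪C, C⟫ = 1 + c ^ 2) (hφC : ∀ p, ⟪(φ p : Euc (m + 1 + 1)), C⟫ = c)
    (hκ : κ ^ 2 = 1 + c ^ 2) (hκa : κ * a = c) :
    IsPartOfUpToIsometry φ {x | (x : Euc (m + 1 + 1)) 0 = a} := by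
  have hnorm : ‖C‖ = ‖κ • (bvec 0 : Euc (m + 1 + 1))‖ := by
    rw [← sq_eq_sq₀ (norm_nonneg _) (norm_nonneg _), ← real_inner_self_eq_norm_sq, hC,
      ← real_inner_self_eq_norm_sq, inner_smul_left, inner_smul_right, inner_bvec_bvec, ← hκ]
    simp [sq]
  -- C and κe₀ have equal length, so the reflection in the hyperplane orthogonal to their difference
  -- exchanges them, and ⟨x, C⟩ = c becomes the condition that the first coordinate is c/κ = a.
  set Ψ : Euc (m + 1 + 1) ≃ₗᵢ[ℝ] Euc (m + 1 + 1) :=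
    (ℝ ∙ (C - κ • (bvec 0 : Euc (m + 1 + 1))))ᗮ.reflection with hΨ
  have hΨC : Ψ C = κ • bvec 0 := Submodule.reflection_sub hnorm
  have hκ0 : κ ≠ 0 := by rintro rfl; nlinarith
  have hcoord : ∀ x : Euc (m + 1 + 1), x 0 = a ↔ ⟪Ψ.symm x, C⟫ = c := by
    intro x
    have : ⟪Ψ.symm x, C⟫ = κ * x 0 := by
      rw [← Ψ.inner_map_map, Ψ.apply_symm_apply, hΨC, inner_smul_right]
      simp [bvec, EuclideanSpace.inner_single_right]
    rw [this, ← hκa, mul_right_inj' hκ0]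
  set A : Set (UnitSphere (m + 1)) := {y | ∃ p, (y : Euc (m + 1 + 1)) = Ψ (φ p)} with hA
  set S : Set (UnitSphere (m + 1)) := {x | (x : Euc (m + 1 + 1)) 0 = a} with hS
  -- This set is open by construction and meets S inside A. The content is that it contains A, which
  -- is `eventually_mem_range` transported by Ψ.
  refine ⟨Ψ, {y | ∀ᶠ z in 𝓝 y, z ∈ S → z ∈ A}, ?_, ?_⟩
  · rw [isOpen_iff_eventually]
    exact fun y hy => hy.eventually_nhds
  · refine Set.Subset.antisymm ?_ fun y hy => hy.1.self_of_nhds hy.2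
    rintro y ⟨p, hp⟩
    refine ⟨?_, (hcoord _).2 (by rw [hp, Ψ.symm_apply_apply, hφC])⟩
    let T : UnitSphere (m + 1) → UnitSphere (m + 1) := fun z => ⟨Ψ.symm z, by simp⟩
    have hT : Continuous T := (Ψ.symm.continuous.comp continuous_subtype_val).subtype_mk _
    have hTy : T y = φ p := Subtype.ext (by simp [T, hp])
    have h1 := hTy ▸ eventually_mem_range hφ hC hφC p
    filter_upwards [hT.continuousAt.eventually h1] with z hz hzS
    obtain ⟨q, hq⟩ := hz ((hcoord _).1 hzS)
    exact ⟨q, by rw [← hq]; simp [T]⟩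

end Sphere

end

end FBiharm

/-! ### The classification in the three space forms -/

open FBiharm in
theorem corollary3p7 (m : ℕ) (hm : 2 ≤ m)
    (M : Type*) [TopologicalSpace M] [ChartedSpace (Euc m) M] [IsManifold (𝓡 m) ∞ M]
    (g : Bundle.ContMDiffRiemannianMetric (𝓡 m) ∞ (Euc m) (fun p : M => TangentSpace (𝓡 m) p)) :
    (∀ φ : M → Euc (m + 1),
      IsIsometricImmersion (metricOf g) (euclideanMetric (m + 1)) φ →
      IsTotallyUmbilical (metricOf g) (euclideanMetric (m + 1)) φ →
      IsFBiharmonic (metricOf g) (euclideanMetric (m + 1)) φ →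
      IsTotallyGeodesic (metricOf g) (euclideanMetric (m + 1)) φ) ∧
    (∀ φ : M → HypSpace (m + 1),
      IsIsometricImmersion (metricOf g) (hyperbolicMetric (m + 1)) φ →
      IsTotallyUmbilical (metricOf g) (hyperbolicMetric (m + 1)) φ →
      IsFBiharmonic (metricOf g) (hyperbolicMetric (m + 1)) φ →
      IsTotallyGeodesic (metricOf g) (hyperbolicMetric (m + 1)) φ) ∧
    (ConnectedSpace M → ∀ φ : M → UnitSphere (m + 1),
      IsIsometricImmersion (metricOf g) (sphereMetric (m + 1)) φ →
      IsTotallyUmbilical (metricOf g) (sphereMetric (m + 1)) φ →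
      IsFBiharmonic (metricOf g) (sphereMetric (m + 1)) φ →
      IsPartOfUpToIsometry φ (greatSphere m) ∨ IsPartOfUpToIsometry φ (smallSphere m)) := by
  refine ⟨fun φ hφ humb hbih => ?_, fun φ hφ humb hbih => ?_, fun _ φ hφ humb hbih => ?_⟩
  · exact isTotallyGeodesic_of_nonpos_curvature hm g (α := 1) (β := 0) (by norm_num)
      (fun e' he' y _ => metricInChart_euclidean he' y) hφ humb hbih
  · exact isTotallyGeodesic_of_nonpos_curvature hm g (α := 1 / 2) (β := -1 / 2) (by norm_num)
      (fun e' he' y hy => metricInChart_hyperbolic he' hy) hφ humb hbih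
  · obtain ⟨C, c, hc, hC, hφC⟩ := exists_smallSphere hm hφ humb hbih
    rcases hc with rfl | hc
    · exact Or.inl (isPartOfUpToIsometry hφ hC hφC (κ := 1) (by norm_num) (by norm_num))
    -- Letting κ carry the sign of c gives the height c/κ = 1/√2 for both c = 1 and c = -1.
    · refine Or.inr (isPartOfUpToIsometry hφ hC hφC (κ := c * Real.sqrt 2) ?_ ?_)
      · rw [mul_pow, Real.sq_sqrt (by norm_num), hc]; norm_num
      · field_simp
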